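/- **Theorem.** Let $\mathcal M$ be a finite integer matrix of multi-stage stochastic shape. That is, the columns of $\mathcal M$ are partitioned among finitely many block matrices $A^{(1)},\dots,A^{(\ell)}$ ($\ell\ge 1$), the block $A^{(i)}$ uses a set $rows(A^{(i)})$ of rows, and $\mathcal M$ is zero outside the blocks. The blocks are the nodes of a rooted tree which is given by inclusion of their row sets: if $A^{(i)}$ lies below $A^{(j)}$ in the tree then $rows(A^{(i)})\subseteq rows(A^{(j)})$, and if neither lies below the other then $rows(A^{(i)})\cap rows(A^{(j)})=\emptyset$. (If two blocks use the same rows, the tree specifies which one is the upper one.) The level of a block is its height in the tree (leaves have level $0$), and the depth $t\ge 0$ of the tree is the level of the root. Let $s_1,\dots,s_t\ge 1$, $r$ and $\Delta$ be integers with $\Delta r\ge 2$ such that every block of level $i\ge 1$ has at most $s_i$ columns, every leaf uses at most $r$ rows, and every entry of $\mathcal M$ is at most $\Delta$ in absolute value. A cycle of $\mathcal M$ is an integer vector $y$ with $\mathcal M y=0$. It is indecomposable if it cannot be written as $y=u+v$ with nonzero cycles $u,v$ such that $u_jv_j\ge 0$ for all $j$. Then every indecomposable cycle $y$ of $\mathcal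 M$ satisfies $$\|y\|_\infty\le T(s_1,\dots,s_t,r,\Delta),\qquad T(r,\Delta)=(\Delta r)^{O(r)},\qquad T(s_1,\dots,s_i,r,\Delta)=2^{\,T(s_1,\dots,s_{i-1},r,\Delta)^{O(s_i^2)}}\quad(1\le i\le t),$$ and $T$ is bounded by a tower of $t+1$ exponentials. Precisely: there is one absolute constant $K$, independent of $\mathcal M,t,s_1,\dots,s_t,r,\Delta$, such that the bound holds with $T(r,\Delta)=(\Delta r)^{Kr}$ and $T(s_1,\dots,s_i,r,\Delta)=2^{\,T(s_1,\dots,s_{i-1},r,\Delta)^{K s_i^2}}$, and such that $T(s_1,\dots,s_t,r,\Delta)\le E_{t+1}\bigl(K\Delta r^2\prod_{i=1}^t K s_i^2\bigr)$, where $E_0(x)=x$ and $E_{k+1}(x)=2^{E_k(x)}$. -/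

import Mathlib

/-- `y` is a cycle of `M`: an integer vector in the kernel of `M`. -/
def IsCycle {m n : Type*} [Fintype n] (M : Matrix m n ℤ) (y : n → ℤ) : Prop :=
  M.mulVec y = 0

/-- `y` is an indecomposable cycle (a Graver element) of `M`: it is a cycle, and it is not the sum
of two nonzero cycles `u`, `v` with `u j * v j ≥ 0` for all `j`. -/
def IsIndecomposableCycle {m n : Type*} [Fintype n] (M : Matrix m n ℤ) (y : n → ℤ) : Prop :=
  IsCycle M y ∧
    ¬ ∃ u v : n → ℤ, IsCycle M u ∧ IsCycle M v ∧ u ≠ 0 ∧ v ≠ 0 ∧ y = u + v ∧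
      ∀ j, 0 ≤ u j * v j

/-- `M` has multi-stage stochastic shape with block matrices indexed by `ι`. The block `a` uses the
set of rows `rows a` and the set of columns `{j | block j = a}`, so that distinct blocks use
disjoint sets of columns; outside of the blocks, `M` is zero.

The blocks form a rooted tree, given by the order on `ι` (the root is `⊤`, the leaves are the
minimal elements, and the elements above a given one form a chain). The order is that of inclusion
of row sets: a block below another one uses a subset of its rows, and two blocks not related in the
tree use disjoint sets of rows. In particular all row sets are contained in that of the root, any
two row sets are nested or disjoint, and `rows a ⊂ rows b` implies `a < b` if `rows a` is nonempty.
Only if two blocks use the same rows does the order add something to inclusion: it then says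
which of the two is the upper one. -/
structure IsMultiStage {m n ι : Type*} [PartialOrder ι] [OrderTop ι]
    (M : Matrix m n ℤ) (rows : ι → Finset m) (block : n → ι) : Prop where
  eq_zero : ∀ i j, i ∉ rows (block j) → M i j = 0
  chain_above : ∀ a b c : ι, a ≤ b → a ≤ c → b ≤ c ∨ c ≤ b
  rows_subset : ∀ a b : ι, a ≤ b → rows a ⊆ rows b
  rows_disjoint : ∀ a b : ι, ¬ a ≤ b → ¬ b ≤ a → Disjoint (rows a) (rows b)

/-- The function `T(s₁, …, s_t, r, Δ)`, with the constant `K` in place of the `O`s: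
`T(r, Δ) = (Δ r) ^ (K r)` and
`T(s₁, …, s_{i+1}, r, Δ) = 2 ^ (T(s₁, …, s_i, r, Δ) ^ (K s_{i+1} ^ 2))`. -/
def stageBound (K : ℕ) (s : ℕ → ℕ) (r Δ : ℕ) : ℕ → ℕ
  | 0 => (Δ * r) ^ (K * r)
  | i + 1 => 2 ^ (stageBound K s r Δ i ^ (K * s (i + 1) ^ 2))

/-- A tower of `k` exponentials: `2 ^ (2 ^ (… ^ (2 ^ x)))`. -/
def expTower : ℕ → ℕ → ℕ
  | 0, x => x
  | k + 1, x => 2 ^ expTower k x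

/-! The core is a bound on basic solutions of linear systems with matrix `M`. For linearly
independent columns, ask for a constant N such that every vector outside their span is detected by
an integer functional of ℓ¹-norm at most N that kills them. Such a functional turns Cramer's rule
into a single fraction: a coordinate of a basic solution has denominator at most ΔN and numerator at
most N times the right-hand side (`Separates.exists_mul_eq`). The constant N is found by climbing
the tree. Sibling subtrees have disjoint rows, so any number of them costs nothing
(`Separates.biUnion`). The at most s columns of the block above them are absorbed by a determinant
of order s + 1 (`Separates.adjoin`).

Now let y be a nonnegative cycle that dominates no other nonzero nonnegative cycle. Let C = ΛΔN,
where Λ bounds common denominators of basic solutions, and let J be the set of coordinates with y_j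
≥ C. If J carries a nonnegative rational cycle, then a circuit on J, scaled to be integral, has
entries at most C. It lies below y, hence equals y. Otherwise the part of y on J solves a system
whose right-hand side comes from the coordinates below C. Each of its coordinates is dominated by
that of a basic solution, hence bounded (`le_of_minimal_nonneg_cycle`).

The right-hand side is controlled by the number of nonzero entries in a row. To bound it, signs are
flipped so that y ≥ 0, and equal columns of a block are merged, which leaves at most (2Δ+1)^r
columns in a leaf. For t ≥ 1 the only exponential comes from the common denominator (ΔN)!, since
each level merely raises N to a power; the tower is a generous bound. -/

/-! ### Separating functionals of bounded norm -/

/-- Row rank equals column rank, with a possibly infinite index set `H`: a linear form vanishing on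
all evaluation vectors would be a relation among the functions `P b`, so these vectors span and
contain a basis. -/
lemma exists_det_ne_zero_of_linearIndependent {κ H : Type*} [Fintype κ] [DecidableEq κ]
    {P : κ → H → ℚ} (hP : LinearIndependent ℚ P) :
    ∃ e : κ → H, (Matrix.of fun a b => P b (e a)).det ≠ 0 := by
  classical
  set R : H → κ → ℚ := fun h b => P b h with hR
  have hspan : Submodule.span ℚ (Set.range R) = ⊤ := by
    by_contra hne
    obtain ⟨f, hf, hle⟩ := Submodule.exists_le_ker_of_lt_top _ (lt_top_iff_ne_top.2 hne)
    apply hf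
    have hzero : ∑ b, f (Pi.single b 1) • P b = 0 := by
      funext h
      have h1 : f (R h) = 0 := hle (Submodule.subset_span ⟨h, rfl⟩)
      rw [LinearMap.pi_apply_eq_sum_univ f (R h)] at h1
      simp only [Finset.sum_apply, Pi.smul_apply, smul_eq_mul, Pi.zero_apply]
      rw [← h1]
      refine Finset.sum_congr rfl fun b _ => ?_
      rw [smul_eq_mul, mul_comm]
      congr 2
      funext j
      simp [Pi.single_apply, eq_comm]
    have := Fintype.linearIndependent_iff.1 hP _ hzero
    refine LinearMap.pi_ext' fun b => LinearMap.ext_ring ?_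
    simpa using this b
  obtain ⟨B, hB, hBs, hBi⟩ := exists_linearIndependent ℚ (Set.range R)
  have hfin : Module.Basis B ℚ (κ → ℚ) := Module.Basis.mk hBi (by
    rw [Subtype.range_coe_subtype]; simp [hBs, hspan])
  have eqv : κ ≃ B := (Pi.basisFun ℚ κ).indexEquiv hfin
  choose g hg using fun b : B => hB b.2
  refine ⟨fun a => g (eqv a), ?_⟩
  have hli : LinearIndependent ℚ
      (Matrix.of fun a b => P b (g (eqv a)) : Matrix κ κ ℚ).row := by
    have : (Matrix.of fun a b => P b (g (eqv a)) : Matrix κ κ ℚ).row = fun a => (eqv a : κ → ℚ) := by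
      funext a
      exact hg (eqv a)
    rw [this]
    exact hBi.comp _ eqv.injective
  rw [Matrix.linearIndependent_rows_iff_isUnit, Matrix.isUnit_iff_isUnit_det] at hli
  exact hli.ne_zero

/-- The `j`-th column of an integer matrix as a rational vector. -/
def ratCol {m n : Type*} (M : Matrix m n ℤ) (j : n) : m → ℚ := fun i => (M i j : ℚ)

/-- Every vector outside of the span of the columns in `S` is separated from it by an integer
functional of `ℓ¹`-norm at most `N`. -/
def Separates {m n : Type*} [Fintype m] (M : Matrix m n ℤ) (S : Set n) (N : ℕ) : Prop :=
  ∀ x : m → ℚ, x ∉ Submodule.span ℚ (ratCol M '' S) →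
    ∃ h : m → ℤ, ∑ i, |h i| ≤ N ∧ (∀ j ∈ S, ∑ i, h i * M i j = 0) ∧ ∑ i, (h i : ℚ) * x i ≠ 0

namespace Separates

variable {m n : Type*} [Fintype m] {M : Matrix m n ℤ} {S : Set n} {N : ℕ}

lemma mono {N' : ℕ} (h : Separates M S N) (hN : N ≤ N') : Separates M S N' := fun x hx => by
  obtain ⟨f, h1, h2, h3⟩ := h x hx
  exact ⟨f, h1.trans (by exact_mod_cast hN), h2, h3⟩

lemma empty : Separates M (∅ : Set n) 1 := fun x hx => by
  classical
  have : x ≠ 0 := by simpa using hx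
  obtain ⟨i, hi⟩ := Function.ne_iff.1 this
  refine ⟨Pi.single i 1, ?_, by simp, ?_⟩
  · simp [Pi.single_apply, apply_ite abs]
  · simpa [Pi.single_apply] using hi

end Separates

lemma abs_sum_mul_le {m : Type*} [Fintype m] (h b : m → ℤ) {N Δ : ℤ} (hN : ∑ i, |h i| ≤ N)
    (hb : ∀ i, |b i| ≤ Δ) (hΔ : 0 ≤ Δ) : |∑ i, h i * b i| ≤ Δ * N :=
  calc |∑ i, h i * b i| ≤ ∑ i, |h i * b i| := Finset.abs_sum_le_sum_abs _ _
    _ ≤ ∑ i, Δ * |h i| := Finset.sum_le_sum fun i _ => by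
        rw [abs_mul, mul_comm]; exact mul_le_mul_of_nonneg_right (hb i) (abs_nonneg _)
    _ = Δ * ∑ i, |h i| := by rw [Finset.mul_sum]
    _ ≤ Δ * N := mul_le_mul_of_nonneg_left hN hΔ

/-- The separation constant after adjoining `s` columns. -/
def adjoinBound (Δ N s : ℕ) : ℕ := (s + 1) * ((s + 1).factorial * (Δ * N) ^ (s + 1)) * N

lemma adjoinBound_mono {Δ N N' s s' : ℕ} (hΔ : 1 ≤ Δ) (hN' : 1 ≤ N') (hN : N ≤ N') (hs : s ≤ s') :
    adjoinBound Δ N s ≤ adjoinBound Δ N' s' := by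
  unfold adjoinBound
  have h1 : 1 ≤ Δ * N' := Nat.mul_pos hΔ hN'
  have h2 : (Δ * N) ^ (s + 1) ≤ (Δ * N') ^ (s' + 1) :=
    (Nat.pow_le_pow_left (Nat.mul_le_mul_left _ hN) _).trans
      (Nat.pow_le_pow_right h1 (by omega))
  have h3 : (s + 1).factorial ≤ (s' + 1).factorial := Nat.factorial_le (by omega)
  gcongr

/-- The functionals of norm at most N that kill `S` still see `x` and the columns in `F` as linearly
independent. Choose |F| + 1 of them with nonzero determinant and combine them with the cofactors
along the column of `x`. The combination takes any vector to the determinant with that column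
replaced, so it kills `F` but not `x`. -/
theorem Separates.adjoin {m n : Type*} [Fintype m] [DecidableEq n] {M : Matrix m n ℤ} {S : Set n}
    {N Δ : ℕ} (hS : Separates M S N) (hM : ∀ i j, |M i j| ≤ (Δ : ℤ)) (hΔ : 1 ≤ Δ) (hN : 1 ≤ N)
    (F : Finset n) (hdisj : Disjoint S (F : Set n))
    (hind : LinearIndepOn ℚ (ratCol M) (S ∪ F)) :
    Separates M (S ∪ F) (adjoinBound Δ N F.card) := by
  classical
  intro x hx
  set W := Submodule.span ℚ (ratCol M '' S) with hW
  let H := {h : m → ℤ // ∑ i, |h i| ≤ N ∧ ∀ j ∈ S, ∑ i, h i * M i j = 0}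
  let w : Option F → m → ℚ := fun o => o.elim x fun j => ratCol M j
  let P : Option F → H → ℚ := fun o h => ∑ i, (h.1 i : ℚ) * w o i
  have hPind : LinearIndependent ℚ P := by
    rw [Fintype.linearIndependent_iff]
    intro g hg
    -- A combination invisible to all small functionals lies in `W`, since `hS` would otherwise
    -- detect it.
    have hmem : ∑ o, g o • w o ∈ W := by
      by_contra hnot
      obtain ⟨h, h1, h2, h3⟩ := hS _ hnot
      apply h3
      have := congrFun hg ⟨h, h1, h2⟩
      simp only [Finset.sum_apply, Pi.smul_apply, smul_eq_mul, Pi.zero_apply, P] at this ⊢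
      rw [← this]
      simp only [Finset.mul_sum]
      rw [Finset.sum_comm]
      refine Finset.sum_congr rfl fun o _ => Finset.sum_congr rfl fun i _ => by ring
    rw [Fintype.sum_option] at hmem
    have hFmem : ∑ j : F, g (some j) • ratCol M j ∈ Submodule.span ℚ (ratCol M '' (F : Set n)) :=
      Submodule.sum_mem _ fun j _ => Submodule.smul_mem _ _ (Submodule.subset_span ⟨j, j.2, rfl⟩)
    have hg0 : g none = 0 := by
      by_contra hne
      apply hx
      have h1 : g none • x ∈ Submodule.span ℚ (ratCol M '' (S ∪ F)) := by
        rw [Set.image_union, Submodule.span_union]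
        have : g none • x = (g none • w none + ∑ j : F, g (some j) • w (some j)) -
            ∑ j : F, g (some j) • ratCol M j := by simp [w]
        rw [this]
        exact Submodule.sub_mem _ (Submodule.mem_sup_left hmem) (Submodule.mem_sup_right hFmem)
      exact (Submodule.smul_mem_iff _ hne).1 h1
    have hmem' : ∑ j : F, g (some j) • ratCol M j ∈ W := by simpa [hg0, w] using hmem
    have hd := (linearIndepOn_union_iff hdisj).1 hind
    have h0 : ∑ j : F, g (some j) • ratCol M j = 0 :=
      Submodule.disjoint_def.1 hd.2.2 _ hmem' hFmem
    have := Fintype.linearIndependent_iff.1 (show LinearIndependent ℚ fun j : F => ratCol M j from hd.2.1) _ h0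
    rintro (_ | j)
    · exact hg0
    · exact this j
  obtain ⟨e, he⟩ := exists_det_ne_zero_of_linearIndependent hPind
  -- The column of the rational vector `x` is filled with zeros; the cofactors along it do not see
  -- it and are integers.
  let Q : Matrix (Option F) (Option F) ℤ := fun a o => o.elim 0 fun j => ∑ i, (e a).1 i * M i j
  let cf : Option F → ℤ := fun a => Q.adjugate none a
  have hcol : ∀ b : Option F → ℤ, ∑ a, cf a * b a = (Q.updateCol none b).det := fun b => by
    have := Matrix.cramer_apply Q b none
    rw [← this, Matrix.cramer_eq_adjugate_mulVec]
    rfl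
  refine ⟨fun i => ∑ a, cf a * (e a).1 i, ?_, ?_, ?_⟩
  · have hcf : ∀ a, |cf a| ≤ (F.card + 1).factorial * ((Δ * N : ℕ) : ℤ) ^ (F.card + 1) := by
      intro a
      simp only [cf, Matrix.adjugate_apply]
      have hone : (1 : ℤ) ≤ (Δ * N : ℕ) := by exact_mod_cast Nat.mul_pos hΔ hN
      have := Matrix.det_le (A := Q.updateRow a (Pi.single none 1)) (abv := AbsoluteValue.abs)
        (x := ((Δ * N : ℕ) : ℤ)) (fun i j => by
          rw [Matrix.updateRow_apply, AbsoluteValue.abs_apply]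
          split_ifs
          · rw [Pi.single_apply]
            split_ifs
            · rw [abs_one]; exact hone
            · rw [abs_zero]; exact zero_le_one.trans hone
          · rcases j with _ | j
            · simpa [Q] using zero_le_one.trans hone
            · have := abs_sum_mul_le (e i).1 (fun k => M k j) (e i).2.1 (fun k => hM k j)
                (by positivity)
              simpa [Q] using this)
      simpa using this
    calc ∑ i, |∑ a, cf a * (e a).1 i| ≤ ∑ i, ∑ a, |cf a| * |(e a).1 i| :=
          Finset.sum_le_sum fun i _ => (Finset.abs_sum_le_sum_abs _ _).trans
            (Finset.sum_le_sum fun a _ => (abs_mul _ _).le)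
      _ = ∑ a, |cf a| * ∑ i, |(e a).1 i| := by
          rw [Finset.sum_comm]; simp only [Finset.mul_sum]
      _ ≤ ∑ a : Option F, ((F.card + 1).factorial * ((Δ * N : ℕ) : ℤ) ^ (F.card + 1)) * N :=
          Finset.sum_le_sum fun a _ => mul_le_mul (hcf a) (e a).2.1
            (Finset.sum_nonneg fun _ _ => abs_nonneg _) (by positivity)
      _ = (adjoinBound Δ N F.card : ℕ) := by
          simp [adjoinBound]; ring
  · have hswap : ∀ j, ∑ i, (∑ a, cf a * (e a).1 i) * M i j
        = ∑ a, cf a * ∑ i, (e a).1 i * M i j := fun j => by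
      simp only [Finset.sum_mul, Finset.mul_sum]
      rw [Finset.sum_comm]
      simp only [mul_assoc]
    rintro j (hj | hj)
    · rw [hswap]
      exact Finset.sum_eq_zero fun a _ => by rw [(e a).2.2 j hj, mul_zero]
    · rw [hswap, hcol]
      refine Matrix.det_zero_of_column_eq (i := none) (j := some ⟨j, hj⟩) (by simp) fun a => ?_
      rw [Matrix.updateCol_self, Matrix.updateCol_ne (by simp)]
      rfl
  · have hswap : ∑ i, ((∑ a, cf a * (e a).1 i : ℤ) : ℚ) * x i
        = ∑ a, (cf a : ℚ) * P none (e a) := by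
      simp only [P, w, Option.elim]
      push_cast
      simp only [Finset.sum_mul, Finset.mul_sum]
      rw [Finset.sum_comm]
      simp only [mul_assoc]
    rw [hswap]
    let Q' : Matrix (Option F) (Option F) ℚ := Q.map (Int.castRingHom ℚ)
    have hadj : ∀ a, (cf a : ℚ) = Q'.adjugate none a := fun a => by
      have := congrFun (congrFun (RingHom.map_adjugate (Int.castRingHom ℚ) Q) none) a
      simpa [Q', cf] using this
    have h1 : ∑ a, (cf a : ℚ) * P none (e a) = (Q'.updateCol none fun a => P none (e a)).det := by
      rw [← Matrix.cramer_apply, Matrix.cramer_eq_adjugate_mulVec]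
      simp only [hadj]
      rfl
    rw [h1]
    convert he using 2
    ext a o
    rcases o with _ | j
    · rw [Matrix.updateCol_self]
      rfl
    · rw [Matrix.updateCol_ne (by simp)]
      simp only [Q', Matrix.map_apply, Matrix.of_apply]
      simp [Q, P, w, ratCol]

/-- The span is a direct sum over disjoint row sets. Either `x` has an entry outside all of them,
detected by a unit functional, or its restriction to one of them lies outside the span there, and a
functional cut down to those rows detects it. The constant does not grow. -/
theorem Separates.biUnion {m n ι : Type*} [Fintype m] {M : Matrix m n ℤ} {N : ℕ} (hN : 1 ≤ N)
    (C : Finset ι) (R : ι → Finset m) (S : ι → Set n)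
    (hdisj : ∀ c ∈ C, ∀ c' ∈ C, c ≠ c' → Disjoint (R c) (R c'))
    (hsupp : ∀ c ∈ C, ∀ j ∈ S c, ∀ i ∉ R c, M i j = 0)
    (hS : ∀ c ∈ C, Separates M (S c) N) : Separates M (⋃ c ∈ C, S c) N := by
  classical
  intro x hx
  by_cases hA : ∃ i, x i ≠ 0 ∧ ∀ c ∈ C, i ∉ R c
  · obtain ⟨i, hi, hiC⟩ := hA
    refine ⟨Pi.single i 1, ?_, ?_, ?_⟩
    · simpa [Pi.single_apply, apply_ite abs] using hN
    · intro j hj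
      simp only [Set.mem_iUnion] at hj
      obtain ⟨c, hc, hj⟩ := hj
      simpa [Pi.single_apply] using hsupp c hc j hj i (hiC c hc)
    · simpa [Pi.single_apply] using hi
  by_cases hB : ∃ c ∈ C, (fun i => if i ∈ R c then x i else 0) ∉
      Submodule.span ℚ (ratCol M '' S c)
  · obtain ⟨c, hc, hxc⟩ := hB
    obtain ⟨h, h1, h2, h3⟩ := hS c hc _ hxc
    refine ⟨fun i => if i ∈ R c then h i else 0, ?_, ?_, ?_⟩
    · refine le_trans (Finset.sum_le_sum fun i _ => ?_) h1
      beta_reduce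
      split_ifs
      · exact le_rfl
      · simp
    · intro j hj
      simp only [Set.mem_iUnion] at hj
      obtain ⟨c', hc', hj⟩ := hj
      by_cases hcc : c = c'
      · subst hcc
        refine (Finset.sum_congr rfl fun i _ => ?_).trans (h2 j hj)
        beta_reduce
        split_ifs with hi
        · rfl
        · rw [hsupp c hc j hj i hi, mul_zero, mul_zero]
      · refine Finset.sum_eq_zero fun i _ => ?_
        beta_reduce
        split_ifs with hi
        · rw [hsupp c' hc' j hj i (Finset.disjoint_left.1 (hdisj c hc c' hc' hcc) hi), mul_zero]
        · rw [zero_mul]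
    · convert h3 using 2 with i
      beta_reduce
      split_ifs <;> simp
  · push Not at hA hB
    refine absurd ?_ hx
    have hsum : x = ∑ c ∈ C, fun i => if i ∈ R c then x i else 0 := by
      funext i
      rw [Finset.sum_apply]
      by_cases hi : x i = 0
      · simp [hi]
      · obtain ⟨c, hc, hic⟩ := hA i hi
        rw [Finset.sum_eq_single_of_mem c hc, if_pos hic]
        intro c' hc' hne
        rw [if_neg (Finset.disjoint_left.1 (hdisj c hc c' hc' hne.symm) hic)]
    rw [hsum]
    refine Submodule.sum_mem _ fun c hc => Submodule.span_mono ?_ (hB c hc)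
    exact Set.image_mono (Set.subset_biUnion_of_mem (u := S) (Finset.mem_coe.2 hc))

/-- Linearly independent columns which are supported in a set of rows are at most as many. -/
lemma card_le_of_linearIndepOn_ratCol {m n : Type*} {M : Matrix m n ℤ}
    {F : Finset n} {R : Finset m} (hF : LinearIndepOn ℚ (ratCol M) (F : Set n))
    (hR : ∀ j ∈ F, ∀ i ∉ R, M i j = 0) : F.card ≤ R.card := by
  classical
  let E : (R → ℚ) →ₗ[ℚ] (m → ℚ) :=
    { toFun := fun z i => if hi : i ∈ R then z ⟨i, hi⟩ else 0
      map_add' := fun z z' => by funext i; by_cases hi : i ∈ R <;> simp [hi]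
      map_smul' := fun a z => by funext i; by_cases hi : i ∈ R <;> simp [hi] }
  have h1 : LinearIndependent ℚ (E ∘ fun (j : F) (i : R) => ratCol M j i) := by
    convert (show LinearIndependent ℚ fun j : F => ratCol M j from hF) using 1
    funext j i
    by_cases hi : i ∈ R
    · simp [E, hi]
    · simp [E, hi, ratCol, hR j j.2 i hi]
  have h2 := (LinearIndependent.of_comp E h1).fintype_card_le_finrank
  simpa using h2

/-! ### Induction over the tree of blocks -/

/-- The separation constant of a block of the given level. -/
def levelBound (s : ℕ → ℕ) (r Δ : ℕ) : ℕ → ℕ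
  | 0 => adjoinBound Δ 1 r
  | k + 1 => adjoinBound Δ (levelBound s r Δ k) (s (k + 1))

lemma le_adjoinBound {Δ N : ℕ} (s : ℕ) (hΔ : 1 ≤ Δ) (hN : 1 ≤ N) : N ≤ adjoinBound Δ N s := by
  unfold adjoinBound
  refine Nat.le_mul_of_pos_left _ ?_
  have : 0 < Δ * N := Nat.mul_pos hΔ hN
  positivity

lemma one_le_levelBound (s : ℕ → ℕ) (r : ℕ) {Δ : ℕ} (hΔ : 1 ≤ Δ) (k : ℕ) :
    1 ≤ levelBound s r Δ k := by
  induction k with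
  | zero => exact le_adjoinBound _ hΔ le_rfl
  | succ k ih => exact ih.trans (le_adjoinBound _ hΔ ih)

lemma levelBound_mono (s : ℕ → ℕ) (r : ℕ) {Δ : ℕ} (hΔ : 1 ≤ Δ) : Monotone (levelBound s r Δ) :=
  monotone_nat_of_le_succ fun k => le_adjoinBound _ hΔ (one_le_levelBound s r hΔ k)

section tree

variable {m n ι : Type*} [Fintype n] [DecidableEq ι] [PartialOrder ι] [OrderTop ι]
  {M : Matrix m n ℤ} {rows : ι → Finset m} {block : n → ι} {s : ℕ → ℕ} {r Δ : ℕ}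

/-- The number of nonzero entries of a row. -/
theorem IsMultiStage.card_row_le (hMS : IsMultiStage M rows block) {q : ℕ}
    (hs : ∀ (a : ι) (k : ℕ), 1 ≤ k → Order.height a = (k : ℕ∞) →
      (Finset.univ.filter fun j : n => block j = a).card ≤ s k)
    (hq : ∀ a : ι, IsMin a → (Finset.univ.filter fun j : n => block j = a).card ≤ q)
    {t : ℕ} (ht : Order.height (⊤ : ι) = (t : ℕ∞)) (i : m) :
    (Finset.univ.filter fun j : n => M i j ≠ 0).card ≤ q + ∑ k ∈ Finset.range t, s (k + 1) := by
  classical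
  have hsub : (Finset.univ.filter fun j : n => M i j ≠ 0) ⊆ (Finset.range (t + 1)).biUnion
      fun k => {j | i ∈ rows (block j) ∧ Order.height (block j) = (k : ℕ∞)} := by
    intro j hj
    simp only [Finset.mem_filter, Finset.mem_univ, true_and, Finset.mem_biUnion,
      Finset.mem_range] at hj ⊢
    have hle : Order.height (block j) ≤ (t : ℕ∞) := ht ▸ Order.height_mono le_top
    obtain ⟨k, hk⟩ := ENat.ne_top_iff_exists.1 (ne_top_of_le_ne_top (ENat.natCast_ne_top t) hle)
    refine ⟨k, ?_, not_not.1 fun h => hj (hMS.eq_zero i j h), hk.symm⟩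
    rw [← hk] at hle
    exact Nat.lt_succ_of_le (by exact_mod_cast hle)
  have hcard : ∀ k : ℕ, ∀ B : ℕ, (∀ a : ι, Order.height a = (k : ℕ∞) →
      (Finset.univ.filter fun j : n => block j = a).card ≤ B) →
      (Finset.univ.filter fun j : n => i ∈ rows (block j) ∧
        Order.height (block j) = (k : ℕ∞)).card ≤ B := by
    intro k B hB
    rcases Finset.eq_empty_or_nonempty (Finset.univ.filter fun j : n => i ∈ rows (block j) ∧
        Order.height (block j) = (k : ℕ∞)) with h | ⟨j₀, hj₀⟩
    · rw [h]; simp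
    · simp only [Finset.mem_filter, Finset.mem_univ, true_and] at hj₀
      refine (Finset.card_le_card fun j hj => ?_).trans (hB (block j₀) hj₀.2)
      simp only [Finset.mem_filter, Finset.mem_univ, true_and] at hj ⊢
      by_contra hne
      -- Blocks sharing row `i` are comparable, and comparable blocks of equal height coincide, so
      -- one block per level meets the row.
      have key : ∀ a b : ι, a < b → Order.height a = (k : ℕ∞) → Order.height b ≠ (k : ℕ∞) :=
        fun a b hab ha hb => by
          have := Order.height_add_one_le hab
          rw [ha, hb] at this
          exact absurd (show k + 1 ≤ k by exact_mod_cast this) (by omega)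
      have hnd : ¬ Disjoint (rows (block j)) (rows (block j₀)) :=
        Finset.not_disjoint_iff.2 ⟨i, hj.1, hj₀.1⟩
      apply hnd
      refine hMS.rows_disjoint _ _ (fun h => ?_) fun h => ?_
      · exact key _ _ (lt_of_le_of_ne h hne) hj.2 hj₀.2
      · exact key _ _ (lt_of_le_of_ne h (Ne.symm hne)) hj₀.2 hj.2
  refine (Finset.card_le_card hsub).trans (Finset.card_biUnion_le.trans ?_)
  rw [Finset.sum_range_succ', add_comm]
  refine Nat.add_le_add (hcard 0 q fun a ha => hq a ?_) (Finset.sum_le_sum fun k _ =>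
    hcard (k + 1) _ fun a ha => hs a (k + 1) (by omega) ha)
  exact Order.height_eq_zero.1 (by simpa using ha)

variable [Fintype m] [Finite ι]

/-- Induction on the height: the children of a block are pairwise incomparable, hence have disjoint
rows, and the columns of the block itself are then adjoined. A leaf starts from the empty set;
independence bounds the number of its chosen columns by its number of rows. -/
theorem IsMultiStage.separates_le (hMS : IsMultiStage M rows block) (hΔ : 1 ≤ Δ)
    (hs : ∀ (a : ι) (k : ℕ), 1 ≤ k → Order.height a = (k : ℕ∞) →
      (Finset.univ.filter fun j : n => block j = a).card ≤ s k)
    (hr : ∀ a : ι, IsMin a → (rows a).card ≤ r)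
    (hM : ∀ i j, |M i j| ≤ (Δ : ℤ)) {S : Set n} (hS : LinearIndepOn ℚ (ratCol M) S) (k : ℕ) :
    ∀ a : ι, Order.height a ≤ k → Separates M {j ∈ S | block j ≤ a} (levelBound s r Δ k) := by
  classical
  have hmin : ∀ a : ι, IsMin a → Separates M {j ∈ S | block j ≤ a} (levelBound s r Δ 0) := by
    intro a ha
    set F : Finset n := {j | j ∈ S ∧ block j = a} with hF
    have heq : {j ∈ S | block j ≤ a} = ∅ ∪ (F : Set n) := by
      ext j
      simp only [Set.mem_ofPred_eq, hF, Finset.coe_filter, Finset.mem_univ, true_and,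
        Set.empty_union, and_congr_right_iff]
      exact fun _ => ⟨fun h => le_antisymm h (ha h), fun h => h.le⟩
    have hsub : (F : Set n) ⊆ S := fun j hj => by
      simp only [hF, Finset.coe_filter, Set.mem_ofPred_eq] at hj
      exact hj.2.1
    have hcard : F.card ≤ r := (card_le_of_linearIndepOn_ratCol (hS.mono hsub) fun j hj i hi => by
      simp only [hF, Finset.mem_filter, Finset.mem_univ, true_and] at hj
      exact hMS.eq_zero i j (by rwa [hj.2])).trans (hr a ha)
    rw [heq]
    refine (Separates.empty.adjoin hM hΔ le_rfl F (by simp) ?_).mono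
      (adjoinBound_mono hΔ le_rfl le_rfl hcard)
    rw [Set.empty_union]
    exact hS.mono hsub
  induction k with
  | zero =>
    intro a ha
    exact hmin a (Order.height_eq_zero.1 (by simpa using ha))
  | succ k ih =>
    intro a ha
    by_cases hak : Order.height a ≤ k
    -- The tree need not be balanced, so blocks of smaller height are carried along by monotonicity.
    · exact (ih a hak).mono (levelBound_mono s r hΔ (Nat.le_succ k))
    have hheight : Order.height a = ((k + 1 : ℕ) : ℕ∞) := by
      refine le_antisymm ha ?_
      push_cast
      exact Order.add_one_le_of_lt (not_le.1 hak)
    have := Fintype.ofFinite ι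
    set C : Finset ι := {c | c ⋖ a} with hC
    have hCmem : ∀ c, c ∈ C ↔ c ⋖ a := fun c => by simp [hC]
    have hchild : Separates M (⋃ c ∈ C, {j ∈ S | block j ≤ c}) (levelBound s r Δ k) := by
      refine Separates.biUnion (one_le_levelBound s r hΔ k) C rows _ ?_ ?_ ?_
      · intro c hc c' hc' hne
        rw [hCmem] at hc hc'
        refine hMS.rows_disjoint c c' (fun h => ?_) fun h => ?_
        · exact hc.2 (lt_of_le_of_ne h hne) hc'.1
        · exact hc'.2 (lt_of_le_of_ne h hne.symm) hc.1
      · intro c _ j hj i hi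
        exact hMS.eq_zero i j fun h => hi (hMS.rows_subset _ _ hj.2 h)
      · intro c hc
        apply ih
        have h1 : Order.height c + 1 ≤ Order.height a := Order.height_add_one_le ((hCmem c).1 hc).1
        rw [hheight] at h1
        push_cast at h1
        exact (ENat.add_le_add_iff_right (by simp)).1 h1
    set F : Finset n := {j | j ∈ S ∧ block j = a} with hF
    have heq : {j ∈ S | block j ≤ a} = (⋃ c ∈ C, {j ∈ S | block j ≤ c}) ∪ (F : Set n) := by
      ext j
      simp only [Set.mem_ofPred_eq, hF, Finset.coe_filter, Finset.mem_univ, true_and,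
        Set.mem_union, Set.mem_iUnion, exists_prop, hCmem]
      constructor
      · rintro ⟨hj, hle⟩
        rcases hle.eq_or_lt with h | h
        · exact Or.inr ⟨hj, h⟩
        · obtain ⟨c, hjc, hc⟩ := exists_le_covBy_of_lt h
          exact Or.inl ⟨c, hc, hj, hjc⟩
      · rintro (⟨c, hc, hj, hle⟩ | ⟨hj, h⟩)
        · exact ⟨hj, hle.trans hc.le⟩
        · exact ⟨hj, h.le⟩
    have hcard : F.card ≤ s (k + 1) :=
      (Finset.card_le_card fun j hj => by
        simp only [hF, Finset.mem_filter, Finset.mem_univ, true_and] at hj ⊢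
        exact hj.2).trans (hs a (k + 1) (by omega) hheight)
    have hdisj : Disjoint (⋃ c ∈ C, {j ∈ S | block j ≤ c}) (F : Set n) := by
      rw [Set.disjoint_left]
      intro j hj hjF
      simp only [Set.mem_ofPred_eq, hF, Finset.coe_filter, Finset.mem_univ, true_and,
        Set.mem_iUnion, exists_prop, hCmem] at hj hjF
      obtain ⟨c, hc, _, hle⟩ := hj
      exact (hle.trans_lt hc.lt).ne hjF.2
    have hsub : (⋃ c ∈ C, {j ∈ S | block j ≤ c}) ∪ (F : Set n) ⊆ S := by
      rw [← heq]
      exact fun j hj => hj.1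
    rw [heq]
    exact (hchild.adjoin hM hΔ (one_le_levelBound s r hΔ k) F hdisj (hS.mono hsub)).mono
      (adjoinBound_mono hΔ (one_le_levelBound s r hΔ k) le_rfl hcard)

theorem IsMultiStage.separates (hMS : IsMultiStage M rows block) (hΔ : 1 ≤ Δ)
    (hs : ∀ (a : ι) (k : ℕ), 1 ≤ k → Order.height a = (k : ℕ∞) →
      (Finset.univ.filter fun j : n => block j = a).card ≤ s k)
    (hr : ∀ a : ι, IsMin a → (rows a).card ≤ r)
    (hM : ∀ i j, |M i j| ≤ (Δ : ℤ)) {t : ℕ} (ht : Order.height (⊤ : ι) = (t : ℕ∞))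
    {S : Set n} (hS : LinearIndepOn ℚ (ratCol M) S) : Separates M S (levelBound s r Δ t) := by
  have := hMS.separates_le hΔ hs hr hM hS t ⊤ ht.le
  simpa using this

end tree

/-! ### Basic solutions and their denominators -/

section solutions

variable {m n : Type*} [Fintype n] {M : Matrix m n ℤ} {S : Set n}

lemma exists_of_not_linearIndepOn {v : n → m → ℚ} (hS : ¬ LinearIndepOn ℚ v S) :
    ∃ d : n → ℚ, d ≠ 0 ∧ (∀ j ∉ S, d j = 0) ∧ ∑ j, d j • v j = 0 := by
  classical
  obtain ⟨g, hg, j, hj⟩ := Fintype.not_linearIndependent_iff.1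
    (show ¬ LinearIndependent ℚ fun j : S => v j from hS)
  refine ⟨fun j => if h : j ∈ S then g ⟨j, h⟩ else 0, fun h => hj ?_, fun j h => by simp [h], ?_⟩
  · simpa using congrFun h j
  · rw [← hg, ← Finset.sum_subset (Finset.subset_univ (Finset.univ.filter (· ∈ S)))
      (fun j _ hj => by
        have : j ∉ S := by simpa using hj
        simp [this])]
    rw [Finset.sum_subtype (p := (· ∈ S)) _ (fun j => by simp)]
    exact Finset.sum_congr rfl fun j _ => by simp

/-- Cramer's rule through a separating functional. -/
theorem Separates.exists_mul_eq [Fintype m] [DecidableEq n] {N Δ B : ℕ}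
    (hM : ∀ i j, |M i j| ≤ (Δ : ℤ)) (hS : LinearIndepOn ℚ (ratCol M) S) {j : n} (hj : j ∈ S)
    (hsep : Separates M (S \ {j}) N) {z : n → ℚ} (hz : ∀ j ∉ S, z j = 0) {b : m → ℤ}
    (hb : ∀ i, |b i| ≤ (B : ℤ)) (hzb : ∑ j, z j • ratCol M j = fun i => (b i : ℚ)) :
    ∃ q p : ℤ, q ≠ 0 ∧ |q| ≤ Δ * N ∧ |p| ≤ B * N ∧ z j * q = p := by
  obtain ⟨h, h1, h2, h3⟩ := hsep _ ((linearIndepOn_iff_notMem_span.1 hS) j hj)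
  refine ⟨∑ i, h i * M i j, ∑ i, h i * b i, fun h0 => h3 ?_, ?_, ?_, ?_⟩
  · have : ((∑ i, h i * M i j : ℤ) : ℚ) = 0 := by rw [h0]; simp
    simpa [ratCol] using this
  · exact abs_sum_mul_le h _ h1 (fun i => hM i j) (by positivity)
  · exact abs_sum_mul_le h _ h1 hb (by positivity)
  · have h4 : ∀ i, (b i : ℚ) = ∑ j, z j * M i j := fun i => by
      have := congrFun hzb i
      simpa [ratCol] using this.symm
    push_cast
    simp only [h4, Finset.mul_sum]
    rw [Finset.sum_comm, Finset.sum_eq_single_of_mem j (Finset.mem_univ j)]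
    · exact Finset.sum_congr rfl fun i _ => by ring
    · intro j' _ hne
      by_cases hj' : j' ∈ S
      · have := h2 j' ⟨hj', hne⟩
        have h5 : (∑ i, (h i : ℚ) * M i j') = 0 := by exact_mod_cast this
        calc ∑ i, (h i : ℚ) * (z j' * M i j') = z j' * ∑ i, (h i : ℚ) * M i j' := by
              rw [Finset.mul_sum]; exact Finset.sum_congr rfl fun i _ => by ring
          _ = 0 := by rw [h5, mul_zero]
      · simp [hz j' hj']

lemma abs_le_of_mul_eq {z : ℚ} {q p : ℤ} {c : ℕ} (hq : q ≠ 0) (hp : |p| ≤ (c : ℤ))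
    (h : z * q = p) : |z| ≤ c := by
  have h1 : (1 : ℚ) ≤ |(q : ℚ)| := by exact_mod_cast Int.one_le_abs hq
  calc |z| ≤ |z| * |(q : ℚ)| := le_mul_of_one_le_right (abs_nonneg _) h1
    _ = |(p : ℚ)| := by rw [← abs_mul, h]
    _ ≤ c := by exact_mod_cast hp

/-- `L` is a common denominator of all solutions supported in the columns `S` of linear systems
with integer right hand side. -/
def IsCommonDenominator (M : Matrix m n ℤ) (S : Set n) (L : ℕ) : Prop :=
  ∀ (z : n → ℚ) (b : m → ℤ), (∀ j ∉ S, z j = 0) →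
    ∑ j, z j • ratCol M j = (fun i => (b i : ℚ)) → ∀ j, ∃ w : ℤ, (L : ℚ) * z j = w

/-- Every coordinate has a denominator at most ΔN, and all of these divide the factorial. -/
theorem isCommonDenominator_factorial [Fintype m] [DecidableEq n] {N Δ : ℕ}
    (hM : ∀ i j, |M i j| ≤ (Δ : ℤ)) (hS : LinearIndepOn ℚ (ratCol M) S)
    (hsep : ∀ j ∈ S, Separates M (S \ {j}) N) :
    IsCommonDenominator M S (Δ * N).factorial := by
  intro z b hz hzb j
  by_cases hj : j ∈ S
  · obtain ⟨q, p, hq, hqN, -, hqp⟩ := (hsep j hj).exists_mul_eq hM hS hj hz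
      -- Any bound on `b` will do: only the denominator is used.
      (B := ∑ i, (b i).natAbs) (fun i => by
        rw [Int.abs_eq_natAbs]
        exact_mod_cast Finset.single_le_sum (f := fun i => (b i).natAbs)
          (fun _ _ => Nat.zero_le _) (Finset.mem_univ i)) hzb
    have hdvd : q ∣ ((Δ * N).factorial : ℤ) := by
      rw [← Int.natAbs_dvd]
      refine Int.natCast_dvd_natCast.2 (Nat.dvd_factorial (Int.natAbs_pos.2 hq) ?_)
      rw [Int.abs_eq_natAbs] at hqN
      exact_mod_cast hqN
    obtain ⟨c, hc⟩ := hdvd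
    refine ⟨c * p, ?_⟩
    have : (((Δ * N).factorial : ℤ) : ℚ) = ((q * c : ℤ) : ℚ) := by rw [hc]
    rw [Int.cast_natCast] at this
    rw [this]
    push_cast
    rw [← hqp]
    ring
  · exact ⟨0, by simp [hz j hj]⟩

/-- Classical Cramer's rule on a nonsingular square submatrix. It serves depth 0, where a factorial
of the separation constant would be too large for (Δr)^{O(r)}. -/
theorem exists_isCommonDenominator_le {r Δ : ℕ} (hΔ : 1 ≤ Δ)
    (hM : ∀ i j, |M i j| ≤ (Δ : ℤ)) (hS : LinearIndepOn ℚ (ratCol M) S) (hr : S.ncard ≤ r) :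
    ∃ L : ℕ, 0 < L ∧ L ≤ r.factorial * Δ ^ r ∧ IsCommonDenominator M S L := by
  classical
  obtain ⟨e, he⟩ := exists_det_ne_zero_of_linearIndependent
    (show LinearIndependent ℚ fun j : S => ratCol M j from hS)
  set Q : Matrix S S ℤ := Matrix.of fun a b => M (e a) b with hQ
  have hcast : (Q.det : ℚ) = (Matrix.of fun a b : S => ratCol M b (e a)).det := by
    have := RingHom.map_det (Int.castRingHom ℚ) Q
    rw [eq_intCast] at this
    rw [this]
    rfl
  have hdet : Q.det ≠ 0 := fun h => he (by rw [← hcast, h]; simp)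
  have hcard : Fintype.card S ≤ r := by rwa [← Nat.card_eq_fintype_card]
  refine ⟨Q.det.natAbs, Int.natAbs_pos.2 hdet, ?_, ?_⟩
  · have h1 := Matrix.det_le (A := Q) (abv := AbsoluteValue.abs) (x := (Δ : ℤ))
      (fun i j => hM _ _)
    rw [AbsoluteValue.abs_apply, Int.abs_eq_natAbs, nsmul_eq_mul] at h1
    have h2 : Q.det.natAbs ≤ (Fintype.card S).factorial * Δ ^ Fintype.card S := by exact_mod_cast h1
    exact h2.trans (Nat.mul_le_mul (Nat.factorial_le hcard) (Nat.pow_le_pow_right hΔ hcard))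
  · intro z b hz hzb j
    by_cases hj : j ∈ S
    · have hsys : (Q.map (Int.castRingHom ℚ)).mulVec (fun a : S => z a) =
          fun a => (b (e a) : ℚ) := by
        funext a
        rw [← congrFun hzb (e a), Finset.sum_apply,
          ← Finset.sum_subset (Finset.subset_univ (Finset.univ.filter (· ∈ S)))
          (fun j _ hj => by simp [hz j (by simpa using hj)]),
          Finset.sum_subtype (p := (· ∈ S)) _ (fun j => by simp)]
        exact Finset.sum_congr rfl fun j _ => by simp [hQ, ratCol, mul_comm]
      have hadj : (Q.det : ℚ) * z j = ((Q.adjugate.mulVec fun a => b (e a)) ⟨j, hj⟩ : ℤ) := by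
        have h1 : (Q.map (Int.castRingHom ℚ)).adjugate.mulVec
            ((Q.map (Int.castRingHom ℚ)).mulVec fun a : S => z a) =
            (Q.map (Int.castRingHom ℚ)).det • fun a : S => z a := by
          rw [Matrix.mulVec_mulVec, Matrix.adjugate_mul, Matrix.smul_mulVec, Matrix.one_mulVec]
        rw [hsys] at h1
        have h2 := congrFun h1 ⟨j, hj⟩
        have h3 : (Q.map (Int.castRingHom ℚ)).det = (Q.det : ℚ) :=
          (RingHom.map_det (Int.castRingHom ℚ) Q).symm
        rw [Pi.smul_apply, smul_eq_mul, h3] at h2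
        rw [← h2]
        have h4 := RingHom.map_adjugate (Int.castRingHom ℚ) Q
        rw [RingHom.mapMatrix_apply, RingHom.mapMatrix_apply] at h4
        rw [← h4]
        simp [Matrix.mulVec, dotProduct]
      generalize (Q.adjugate.mulVec fun a => b (e a)) ⟨j, hj⟩ = w at hadj
      rcases abs_choice Q.det with h | h
      · exact ⟨w, by rw [Nat.cast_natAbs, h, hadj]⟩
      · exact ⟨-w, by rw [Nat.cast_natAbs, h, Int.cast_neg, Int.cast_neg, ← hadj, neg_mul]⟩
    · exact ⟨0, by simp [hz j hj]⟩

/-! ### Minimal supports -/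

/-- Moving along a direction until a coordinate vanishes. -/
lemma exists_step {z d : n → ℚ} (hz : ∀ j, 0 ≤ z j) (hd : ∀ j, z j = 0 → d j = 0)
    (hpos : ∃ j, 0 < d j) :
    ∃ τ : ℚ, 0 ≤ τ ∧ (∀ j, 0 ≤ z j - τ * d j) ∧
      (Finset.univ.filter fun j => z j - τ * d j ≠ 0).card <
        (Finset.univ.filter fun j => z j ≠ 0).card := by
  classical
  obtain ⟨j₀, hj₀⟩ := hpos
  obtain ⟨j₁, hj₁, hmin⟩ := Finset.exists_min_image (Finset.univ.filter fun j => 0 < d j)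
    (fun j => z j / d j) ⟨j₀, by simpa using hj₀⟩
  have hd₁ : 0 < d j₁ := by simpa using hj₁
  -- The ratio test: the largest step that preserves nonnegativity.
  refine ⟨z j₁ / d j₁, div_nonneg (hz _) hd₁.le, fun j => ?_, ?_⟩
  · rcases lt_or_ge 0 (d j) with h | h
    · have := hmin j (by simpa using h)
      rw [le_div_iff₀ h] at this
      exact sub_nonneg.2 this
    · have := mul_nonpos_of_nonneg_of_nonpos (div_nonneg (hz j₁) hd₁.le) h
      linarith [hz j]
  · refine Finset.card_lt_card (Finset.ssubset_iff_subset_ne.2 ⟨fun j hj => ?_, fun h => ?_⟩)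
    · simp only [Finset.mem_filter, Finset.mem_univ, true_and] at hj ⊢
      intro h0
      apply hj
      rw [h0, hd j h0]
      simp
    · have h1 : j₁ ∈ Finset.univ.filter fun j => z j ≠ 0 := by
        simp only [Finset.mem_filter, Finset.mem_univ, true_and]
        exact fun h0 => hd₁.ne' (hd _ h0)
      rw [← h] at h1
      simp only [Finset.mem_filter, Finset.mem_univ, true_and] at h1
      apply h1
      field_simp
      ring

lemma sum_sub_smul_ratCol (z d : n → ℚ) (τ : ℚ) (hd : ∑ j, d j • ratCol M j = 0) :
    ∑ j, (z j - τ * d j) • ratCol M j = ∑ j, z j • ratCol M j := by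
  simp only [sub_smul, mul_smul, Finset.sum_sub_distrib, ← Finset.smul_sum, hd, smul_zero, sub_zero]

/-- A nonnegative cycle of minimal support. -/
theorem exists_nonneg_circuit [DecidableEq n] {J : Set n} {w : n → ℚ} (hw : ∀ j, 0 ≤ w j)
    (hw0 : w ≠ 0) (hJ : ∀ j ∉ J, w j = 0) (hcyc : ∑ j, w j • ratCol M j = 0) :
    ∃ (c : n → ℚ) (j₀ : n), (∀ j, 0 ≤ c j) ∧ c j₀ = 1 ∧ (∀ j ∉ J, c j = 0) ∧
      ∑ j, c j • ratCol M j = 0 ∧ LinearIndepOn ℚ (ratCol M) ({j | c j ≠ 0} \ {j₀}) := by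
  let P : Set (n → ℚ) := {w | (∀ j, 0 ≤ w j) ∧ w ≠ 0 ∧ (∀ j ∉ J, w j = 0) ∧
    ∑ j, w j • ratCol M j = 0}
  obtain ⟨c, ⟨hc, hc0, hcJ, hccyc⟩, hcmin⟩ := (measure fun w : n → ℚ =>
    (Finset.univ.filter fun j => w j ≠ 0).card).wf.has_min P ⟨w, hw, hw0, hJ, hcyc⟩
  obtain ⟨j₀, hj₀⟩ := Function.ne_iff.1 hc0
  have hj₀ : c j₀ ≠ 0 := hj₀
  have hsupp : ∀ j, (c j₀)⁻¹ * c j ≠ 0 ↔ c j ≠ 0 := fun j => by simp [hj₀]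
  refine ⟨fun j => (c j₀)⁻¹ * c j, j₀, fun j => mul_nonneg (inv_nonneg.2 (hc _)) (hc _),
    inv_mul_cancel₀ hj₀, fun j hj => by simp [hcJ j hj], ?_, ?_⟩
  · simp only [mul_smul, ← Finset.smul_sum, hccyc, smul_zero]
  · simp only [hsupp]
    by_contra hdep
    obtain ⟨d, hd0, hdS, hd⟩ := exists_of_not_linearIndepOn hdep
    have hpos : ∃ d : n → ℚ, (∃ j, 0 < d j) ∧ (∀ j ∉ {j | c j ≠ 0} \ {j₀}, d j = 0) ∧
        ∑ j, d j • ratCol M j = 0 := by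
      by_cases h : ∃ j, 0 < d j
      · exact ⟨d, h, hdS, hd⟩
      · push Not at h
        obtain ⟨j, hj⟩ := Function.ne_iff.1 hd0
        refine ⟨-d, ⟨j, neg_pos.2 (lt_of_le_of_ne (h j) hj)⟩, fun j hj => by simp [hdS j hj], ?_⟩
        simp [hd]
    obtain ⟨d, hdpos, hdS, hd⟩ := hpos
    obtain ⟨τ, hτ, hnonneg, hlt⟩ := exists_step hc (fun j hj => hdS j (by simp [hj])) hdpos
    refine hcmin (fun j => c j - τ * d j) ⟨hnonneg, fun h => hj₀ ?_, fun j hj => ?_, ?_⟩ hlt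
    -- The direction vanishes at `j₀`, so the shortened cycle is still nonzero.
    · have := congrFun h j₀
      simpa [hdS j₀ (by simp)] using this
    · simp [hcJ j hj, hdS j (by simp [hcJ j hj])]
    · rw [sum_sub_smul_ratCol _ _ _ hd, hccyc]

/-- If there is no nonnegative cycle on `J`, then a coordinate of a nonnegative solution is
dominated by that of a basic one. -/
theorem exists_basic_solution {J : Set n} (j₀ : n) {x : n → ℚ}
    (hno : ∀ w : n → ℚ, (∀ j, 0 ≤ w j) → (∀ j ∉ J, w j = 0) → ∑ j, w j • ratCol M j = 0 → w = 0)
    (hx : ∀ j, 0 ≤ x j) (hxJ : ∀ j ∉ J, x j = 0) :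
    ∃ z : n → ℚ, ∑ j, z j • ratCol M j = ∑ j, x j • ratCol M j ∧ x j₀ ≤ z j₀ ∧
      LinearIndepOn ℚ (ratCol M) {j | z j ≠ 0} := by
  let P : Set (n → ℚ) := {z | (∀ j, 0 ≤ z j) ∧ (∀ j ∉ J, z j = 0) ∧ x j₀ ≤ z j₀ ∧
    ∑ j, z j • ratCol M j = ∑ j, x j • ratCol M j}
  obtain ⟨z, ⟨hz, hzJ, hz₀, hzx⟩, hzmin⟩ := (measure fun w : n → ℚ =>
    (Finset.univ.filter fun j => w j ≠ 0).card).wf.has_min P ⟨x, hx, hxJ, le_rfl, rfl⟩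
  refine ⟨z, hzx, hz₀, ?_⟩
  by_contra hdep
  obtain ⟨d, hd0, hdS, hd⟩ := exists_of_not_linearIndepOn hdep
  have hdJ : ∀ j ∉ J, d j = 0 := fun j hj => hdS j (by simp [hzJ j hj])
  have hnpos : ∃ j, 0 < d j := by
    by_contra h
    push Not at h
    refine hd0 (neg_eq_zero.1 (hno (-d) (fun j => neg_nonneg.2 (h j)) (fun j hj => ?_) ?_))
    · simp [hdJ j hj]
    · simp [hd]
  have hnneg : ∃ j, d j < 0 := by
    by_contra h
    push Not at h
    exact hd0 (hno d h hdJ hd)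
  -- As `d` takes both signs, it may be negated so as not to decrease coordinate `j₀` and still make
  -- some coordinate drop to zero.
  have hdir : ∃ d : n → ℚ, (∃ j, 0 < d j) ∧ d j₀ ≤ 0 ∧ (∀ j, z j = 0 → d j = 0) ∧
      ∑ j, d j • ratCol M j = 0 := by
    rcases le_total (d j₀) 0 with h | h
    · exact ⟨d, hnpos, h, fun j hj => hdS j (by simp [hj]), hd⟩
    · obtain ⟨j, hj⟩ := hnneg
      exact ⟨-d, ⟨j, neg_pos.2 hj⟩, neg_nonpos.2 h, fun j hj => by simp [hdS j (by simp [hj])],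
        by simp [hd]⟩
  obtain ⟨d, hdpos, hd₀, hdS, hd⟩ := hdir
  obtain ⟨τ, hτ, hnonneg, hlt⟩ := exists_step hz hdS hdpos
  refine hzmin (fun j => z j - τ * d j) ⟨hnonneg, fun j hj => ?_, ?_, ?_⟩ hlt
  · simp [hzJ j hj, hdS j (hzJ j hj)]
  · have := mul_nonpos_of_nonneg_of_nonpos hτ hd₀
    linarith
  · rw [sum_sub_smul_ratCol _ _ _ hd, hzx]

end solutions

/-! ### Minimal nonnegative cycles -/

lemma isCycle_iff_sum_smul_ratCol {m n : Type*} [Fintype n] {M : Matrix m n ℤ} {u : n → ℤ} :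
    IsCycle M u ↔ ∑ j, (u j : ℚ) • ratCol M j = 0 := by
  simp only [IsCycle, funext_iff, Matrix.mulVec, dotProduct, Finset.sum_apply, Pi.smul_apply,
    smul_eq_mul, ratCol, Pi.zero_apply]
  refine forall_congr' fun i => ?_
  rw [← Int.cast_inj (α := ℚ)]
  push_cast
  simp only [mul_comm]

/-- A nonnegative rational cycle yields an integer one whose size and support are bounded. -/
theorem exists_bounded_nonneg_cycle {m n : Type*} [Fintype m] [Fintype n] {M : Matrix m n ℤ}
    {Δ N Λ : ℕ} (hΔ : 1 ≤ Δ) (hN : 1 ≤ N) (hM : ∀ i j, |M i j| ≤ (Δ : ℤ))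
    (hsep : ∀ S, LinearIndepOn ℚ (ratCol M) S → Separates M S N)
    (hden : ∀ S, LinearIndepOn ℚ (ratCol M) S → ∃ L, 0 < L ∧ L ≤ Λ ∧ IsCommonDenominator M S L)
    {J : Set n} {w : n → ℚ} (hw : ∀ j, 0 ≤ w j) (hw0 : w ≠ 0) (hwJ : ∀ j ∉ J, w j = 0)
    (hwcyc : ∑ j, w j • ratCol M j = 0) :
    ∃ u : n → ℤ, (∀ j, 0 ≤ u j) ∧ (∀ j, u j ≤ (Λ * Δ * N : ℕ)) ∧ (∀ j ∉ J, u j = 0) ∧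
      IsCycle M u ∧ u ≠ 0 := by
  classical
  have hΔN : 1 ≤ Δ * N := Nat.mul_pos hΔ hN
  obtain ⟨c, j₀, hc, hc₀, hcJ, hccyc, hind⟩ := exists_nonneg_circuit hw hw0 hwJ hwcyc
  set S : Set n := {j | c j ≠ 0} \ {j₀} with hS
  -- Moving column `j₀` to the right makes the circuit a basic solution with right-hand side bounded
  -- by Δ.
  set z : n → ℚ := fun j => if j = j₀ then 0 else c j with hz
  have hzS : ∀ j ∉ S, z j = 0 := fun j hj => by
    by_cases h : j = j₀
    · simp [hz, h]
    · have : c j = 0 := by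
        by_contra hne
        exact hj ⟨hne, h⟩
      simp [hz, this]
  have hzb : ∑ j, z j • ratCol M j = fun i => ((-M i j₀ : ℤ) : ℚ) := by
    have h1 : ∑ j, z j • ratCol M j + ratCol M j₀ = 0 := by
      rw [← hccyc, ← Finset.add_sum_erase _ _ (Finset.mem_univ j₀),
        ← Finset.add_sum_erase _ (fun j => c j • ratCol M j) (Finset.mem_univ j₀), hc₀]
      simp only [hz, if_true, zero_smul, zero_add, one_smul]
      rw [add_comm]
      congr 1
      exact Finset.sum_congr rfl fun j hj => by rw [if_neg (Finset.ne_of_mem_erase hj)]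
    rw [eq_neg_of_add_eq_zero_left h1]
    funext i
    simp [ratCol]
  obtain ⟨L, hL0, hLΛ, hL⟩ := hden S hind
  have hint : ∀ j, ∃ u : ℤ, (L : ℚ) * c j = u := fun j => by
    by_cases h : j = j₀
    · exact ⟨L, by simp [h, hc₀]⟩
    · obtain ⟨u, hu⟩ := hL z _ hzS hzb j
      exact ⟨u, by simpa [hz, h] using hu⟩
  choose u hu using hint
  have hcle : ∀ j, c j ≤ (Δ * N : ℕ) := fun j => by
    by_cases h : j = j₀
    · rw [h, hc₀]
      exact_mod_cast hΔN
    by_cases hjS : j ∈ S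
    · obtain ⟨q, p, hq, -, hp, hqp⟩ := (hsep (S \ {j}) (hind.mono Set.sdiff_subset)).exists_mul_eq
        hM hind hjS hzS (B := Δ) (fun i => by rw [abs_neg]; exact hM i j₀) hzb
      have := abs_le_of_mul_eq hq (c := Δ * N) (by exact_mod_cast hp) hqp
      rw [show z j = c j by simp [hz, h]] at this
      exact (le_abs_self _).trans this
    · have : z j = 0 := hzS j hjS
      rw [show z j = c j by simp [hz, h]] at this
      rw [this]
      positivity
  have hu0 : ∀ j, 0 ≤ u j := fun j => by
    have : (0 : ℚ) ≤ u j := by rw [← hu]; exact mul_nonneg (by positivity) (hc j)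
    exact_mod_cast this
  have huC : ∀ j, u j ≤ (Λ * Δ * N : ℕ) := fun j => by
    have h1 : (L : ℚ) * c j ≤ (Λ : ℚ) * (Δ * N : ℕ) :=
      mul_le_mul (by exact_mod_cast hLΛ) (hcle j) (hc j) (by positivity)
    rw [hu, mul_assoc] at *
    exact_mod_cast h1
  have huJ : ∀ j ∉ J, u j = 0 := fun j h => by
    have h1 := hu j
    rw [hcJ j h, mul_zero] at h1
    exact_mod_cast h1.symm
  have hucyc : IsCycle M u := by
    rw [isCycle_iff_sum_smul_ratCol]
    simp only [← hu, mul_smul, ← Finset.smul_sum, hccyc, smul_zero]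
  have hune : u ≠ 0 := fun h => by
    have h1 := hu j₀
    rw [h, hc₀, mul_one, Pi.zero_apply] at h1
    exact hL0.ne' (by exact_mod_cast h1)
  exact ⟨u, hu0, huC, huJ, hucyc, hune⟩

/-- If the coordinates of size at least `C` support no nonnegative cycle, then they are bounded. -/
theorem le_of_no_nonneg_cycle {m n : Type*} [Fintype m] [Fintype n] {M : Matrix m n ℤ}
    {Δ N C ρ : ℕ} (hM : ∀ i j, |M i j| ≤ (Δ : ℤ))
    (hsep : ∀ S, LinearIndepOn ℚ (ratCol M) S → Separates M S N)
    (hρ : ∀ i, (Finset.univ.filter fun j => M i j ≠ 0).card ≤ ρ)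
    {y : n → ℤ} (hy : ∀ j, 0 ≤ y j) (hcyc : IsCycle M y)
    {J : Set n} (hJ : ∀ j ∉ J, y j ≤ C)
    (hno : ∀ w : n → ℚ, (∀ j, 0 ≤ w j) → (∀ j ∉ J, w j = 0) →
      ∑ j, w j • ratCol M j = 0 → w = 0) {k : n} (hk : k ∈ J) :
    y k ≤ (ρ * Δ * C * N : ℕ) := by
  classical
  obtain ⟨z, hzx, hzk, hind⟩ := exists_basic_solution k
    (x := fun j => if j ∈ J then (y j : ℚ) else 0) hno
    (fun j => by split_ifs <;> [exact_mod_cast hy j; exact le_rfl])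
    (fun j hj => if_neg hj)
  -- The contribution of the small coordinates; a row has at most ρ nonzero entries, which gives the
  -- bound ρΔC.
  set b : m → ℤ := fun i => -∑ j, M i j * (if j ∈ J then 0 else y j) with hb
  have hbB : ∀ i, |b i| ≤ ((ρ * Δ * C : ℕ) : ℤ) := fun i => by
    rw [hb, abs_neg]
    calc |∑ j, M i j * (if j ∈ J then 0 else y j)|
        ≤ ∑ j, |M i j * (if j ∈ J then 0 else y j)| := Finset.abs_sum_le_sum_abs _ _
      _ = ∑ j with M i j ≠ 0, |M i j * (if j ∈ J then 0 else y j)| := by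
          rw [Finset.sum_filter]
          refine Finset.sum_congr rfl fun j _ => ?_
          split_ifs with h <;> simp_all
      _ ≤ ∑ j with M i j ≠ 0, (Δ * C : ℤ) := by
          refine Finset.sum_le_sum fun j _ => ?_
          rw [abs_mul]
          refine mul_le_mul (hM i j) ?_ (abs_nonneg _) (by positivity)
          split_ifs with h
          · simp
          · rw [abs_of_nonneg (hy j)]
            exact hJ j h
      _ ≤ ρ * (Δ * C : ℤ) := by
          rw [Finset.sum_const, nsmul_eq_mul]
          exact mul_le_mul_of_nonneg_right (by exact_mod_cast hρ i) (by positivity)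
      _ = ((ρ * Δ * C : ℕ) : ℤ) := by push_cast; ring
  have hzb : ∑ j, z j • ratCol M j = fun i => (b i : ℚ) := by
    rw [hzx]
    have h1 := isCycle_iff_sum_smul_ratCol.1 hcyc
    funext i
    have h2 := congrFun h1 i
    simp only [Finset.sum_apply, Pi.smul_apply, smul_eq_mul, ratCol, Pi.zero_apply] at h2 ⊢
    rw [hb]
    push_cast
    rw [eq_neg_iff_add_eq_zero, ← Finset.sum_add_distrib]
    refine (Finset.sum_congr rfl fun j _ => ?_).trans h2
    split_ifs <;> simp [mul_comm]
  have hzk' : (y k : ℚ) ≤ z k := by simpa [hk] using hzk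
  by_cases hzk0 : z k = 0
  · rw [hzk0] at hzk'
    exact (show y k ≤ 0 by exact_mod_cast hzk').trans (by positivity)
  obtain ⟨q, p, hq, -, hp, hqp⟩ := (hsep ({j | z j ≠ 0} \ {k})
    (hind.mono Set.sdiff_subset)).exists_mul_eq hM hind (show k ∈ {j | z j ≠ 0} from hzk0)
    (fun j hj => by simpa using hj) hbB hzb
  have := abs_le_of_mul_eq hq (c := ρ * Δ * C * N) (by exact_mod_cast hp) hqp
  have h2 : (y k : ℚ) ≤ ((ρ * Δ * C * N : ℕ) : ℚ) := hzk'.trans ((le_abs_self _).trans this)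
  exact_mod_cast h2

/-- The bound for the minimal nonnegative cycles, from the sizes and the denominators of the basic
solutions of the linear systems. -/
theorem le_of_minimal_nonneg_cycle {m n : Type*} [Fintype m] [Fintype n] {M : Matrix m n ℤ}
    {Δ N Λ ρ : ℕ} (hΔ : 1 ≤ Δ) (hN : 1 ≤ N) (hM : ∀ i j, |M i j| ≤ (Δ : ℤ))
    (hsep : ∀ S, LinearIndepOn ℚ (ratCol M) S → Separates M S N)
    (hden : ∀ S, LinearIndepOn ℚ (ratCol M) S → ∃ L, 0 < L ∧ L ≤ Λ ∧ IsCommonDenominator M S L)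
    (hρ : ∀ i, (Finset.univ.filter fun j => M i j ≠ 0).card ≤ ρ)
    {y : n → ℤ} (hy : ∀ j, 0 ≤ y j) (hcyc : IsCycle M y)
    (hmin : ∀ u : n → ℤ, (∀ j, 0 ≤ u j) → (∀ j, u j ≤ y j) → IsCycle M u → u = 0 ∨ u = y) (k : n) :
    y k ≤ (Λ * Δ * N * (ρ * Δ * N + 1) : ℕ) := by
  classical
  have hCle : Λ * Δ * N ≤ Λ * Δ * N * (ρ * Δ * N + 1) :=
    Nat.le_mul_of_pos_right _ (Nat.succ_pos _)
  set J : Set n := {j | ((Λ * Δ * N : ℕ) : ℤ) ≤ y j} with hJ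
  by_cases hex : ∃ w : n → ℚ, (∀ j, 0 ≤ w j) ∧ (∀ j ∉ J, w j = 0) ∧
      ∑ j, w j • ratCol M j = 0 ∧ w ≠ 0
  · obtain ⟨w, hw, hwJ, hwcyc, hw0⟩ := hex
    obtain ⟨u, hu0, huC, huJ, hucyc, hune⟩ :=
      exists_bounded_nonneg_cycle hΔ hN hM hsep hden hw hw0 hwJ hwcyc
    have huy : ∀ j, u j ≤ y j := fun j => by
      by_cases h : j ∈ J
      · exact (huC j).trans h
      · rw [huJ j h]
        exact hy j
    rw [← (hmin u hu0 huy hucyc).resolve_left hune]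
    exact (huC k).trans (Int.ofNat_le.2 hCle)
  · by_cases hk : k ∈ J
    · have h1 := le_of_no_nonneg_cycle hM hsep hρ hy hcyc (C := Λ * Δ * N)
        (fun j hj => (not_le.1 hj).le)
        (fun w h1 h2 h3 => by
          by_contra h4
          exact hex ⟨w, h1, h2, h3, h4⟩) hk
      refine h1.trans (Int.ofNat_le.2 ?_)
      calc ρ * Δ * (Λ * Δ * N) * N = Λ * Δ * N * (ρ * Δ * N) := by ring
        _ ≤ _ := Nat.mul_le_mul_left _ (Nat.le_succ _)
    · exact (not_le.1 hk).le.trans (Int.ofNat_le.2 hCle)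

/-- The bound for the common denominators of the basic solutions. -/
def denominatorBound (s : ℕ → ℕ) (r Δ : ℕ) : ℕ → ℕ
  | 0 => r.factorial * Δ ^ r
  | t + 1 => (Δ * levelBound s r Δ (t + 1)).factorial

/-- The bound for the indecomposable cycles if leaves have at most `q` columns. -/
def cycleBound (s : ℕ → ℕ) (r Δ q t : ℕ) : ℕ :=
  denominatorBound s r Δ t * Δ * levelBound s r Δ t *
    ((q + ∑ k ∈ Finset.range t, s (k + 1)) * Δ * levelBound s r Δ t + 1)

theorem IsMultiStage.le_of_minimal_nonneg_cycle {m n ι : Type*} [Fintype m] [Fintype n] [Finite ι]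
    [DecidableEq ι] [PartialOrder ι] [OrderTop ι]
    {M : Matrix m n ℤ} {rows : ι → Finset m} {block : n → ι} {s : ℕ → ℕ} {r Δ q t : ℕ}
    (hMS : IsMultiStage M rows block) (hΔ : 1 ≤ Δ)
    (ht : Order.height (⊤ : ι) = (t : ℕ∞))
    (hs : ∀ (a : ι) (k : ℕ), 1 ≤ k → Order.height a = (k : ℕ∞) →
      (Finset.univ.filter fun j : n => block j = a).card ≤ s k)
    (hr : ∀ a : ι, IsMin a → (rows a).card ≤ r)
    (hq : ∀ a : ι, IsMin a → (Finset.univ.filter fun j : n => block j = a).card ≤ q)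
    (hM : ∀ i j, |M i j| ≤ (Δ : ℤ)) {y : n → ℤ} (hy : ∀ j, 0 ≤ y j) (hcyc : IsCycle M y)
    (hmin : ∀ u : n → ℤ, (∀ j, 0 ≤ u j) → (∀ j, u j ≤ y j) → IsCycle M u → u = 0 ∨ u = y) (k : n) :
    y k ≤ cycleBound s r Δ q t := by
  classical
  have hsep : ∀ S, LinearIndepOn ℚ (ratCol M) S → Separates M S (levelBound s r Δ t) :=
    fun S hS => hMS.separates hΔ hs hr hM ht hS
  refine _root_.le_of_minimal_nonneg_cycle hΔ (one_le_levelBound s r hΔ t) hM hsep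
    (fun S hS => ?_) (hMS.card_row_le hs hq ht) hy hcyc hmin k
  -- At depth 0 the root is the only leaf, and all columns live on at most `r` rows.
  cases t with
  | zero =>
    refine exists_isCommonDenominator_le hΔ hM hS ?_
    have htop : IsMin (⊤ : ι) := Order.height_eq_zero.1 (by simpa using ht)
    rw [Set.ncard_eq_toFinset_card S S.toFinite]
    refine (card_le_of_linearIndepOn_ratCol (by simpa using hS) fun j _ i hi => ?_).trans
      (hr ⊤ htop)
    exact hMS.eq_zero i j fun h => hi (hMS.rows_subset _ _ le_top h)
  | succ t =>
    exact ⟨_, Nat.factorial_pos _, le_rfl, isCommonDenominator_factorial hM hS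
      fun j _ => hsep _ (hS.mono Set.sdiff_subset)⟩

/-! ### Flipping signs and merging equal columns -/

/-- Greedy filling. It distributes a cycle of the merged matrix over the original columns without
exceeding |y|. -/
lemma exists_le_sum_eq {α : Type*} (F : Finset α) {a : α → ℤ} (ha : ∀ j, 0 ≤ a j) :
    ∀ B : ℤ, 0 ≤ B → B ≤ ∑ j ∈ F, a j →
      ∃ b : α → ℤ, (∀ j, 0 ≤ b j) ∧ (∀ j, b j ≤ a j) ∧ ∑ j ∈ F, b j = B := by
  classical
  induction F using Finset.induction_on with
  | empty =>
    intro B hB hB'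
    exact ⟨0, fun _ => le_rfl, ha, by simpa using le_antisymm hB (by simpa using hB')⟩
  | insert k F hk ih =>
    intro B hB hB'
    rw [Finset.sum_insert hk] at hB'
    obtain ⟨b, hb0, hba, hbs⟩ := ih (B - min (a k) B) (by simp) (by
      have := Finset.sum_nonneg fun j (_ : j ∈ F) => ha j
      rcases min_cases (a k) B with h | h <;> omega)
    refine ⟨Function.update b k (min (a k) B), fun j => ?_, fun j => ?_, ?_⟩
    · by_cases h : j = k
      · subst h
        simpa using ⟨ha j, hB⟩
      · simpa [h] using hb0 j
    · by_cases h : j = k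
      · subst h
        simp
      · simpa [h] using hba j
    · rw [Finset.sum_insert hk, Function.update_self,
        Finset.sum_congr rfl fun j hj => Function.update_of_ne (ne_of_mem_of_not_mem hj hk) _ _, hbs]
      ring

/-- The number of integer vectors with entries in `[-Δ, Δ]` which are supported in `R`. -/
lemma card_le_of_supported {m : Type*} {V : Finset (m → ℤ)} {R : Finset m} {Δ : ℕ}
    (hΔ : ∀ v ∈ V, ∀ i, |v i| ≤ (Δ : ℤ)) (hR : ∀ v ∈ V, ∀ i ∉ R, v i = 0) :
    V.card ≤ (2 * Δ + 1) ^ R.card := by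
  classical
  have h := Finset.card_le_card_of_injOn (s := V)
    (t := Fintype.piFinset fun _ : R => Finset.Icc (-(Δ : ℤ)) Δ) (fun v i => v i)
    (fun v hv => by
      simp only [Finset.mem_coe, Fintype.mem_piFinset, Finset.mem_Icc]
      exact fun i => abs_le.1 (hΔ v hv i))
    (fun v hv w hw hvw => by
      funext i
      by_cases hi : i ∈ R
      · exact congrFun hvw ⟨i, hi⟩
      · rw [hR v hv i hi, hR w hw i hi])
  refine h.trans_eq ?_
  rw [Fintype.card_piFinset, Finset.prod_const, Finset.card_univ, Fintype.card_coe, Int.card_Icc]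
  congr 1
  omega

/-- Flipping the signs of columns and merging equal columns of the same block reduces the bound for
indecomposable cycles to that for minimal nonnegative cycles. -/
theorem IsMultiStage.abs_le_of_isIndecomposableCycle {m n ι : Type*} [Fintype m] [Fintype n]
    [Finite ι] [DecidableEq ι] [PartialOrder ι] [OrderTop ι]
    {M : Matrix m n ℤ} {rows : ι → Finset m} {block : n → ι} {s : ℕ → ℕ} {r Δ t : ℕ}
    (hMS : IsMultiStage M rows block) (hΔ : 1 ≤ Δ)
    (ht : Order.height (⊤ : ι) = (t : ℕ∞))
    (hs : ∀ (a : ι) (k : ℕ), 1 ≤ k → Order.height a = (k : ℕ∞) →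
      (Finset.univ.filter fun j : n => block j = a).card ≤ s k)
    (hr : ∀ a : ι, IsMin a → (rows a).card ≤ r)
    (hM : ∀ i j, |M i j| ≤ (Δ : ℤ)) {y : n → ℤ} (hy : IsIndecomposableCycle M y) (k : n) :
    |y k| ≤ cycleBound s r Δ ((2 * Δ + 1) ^ r) t := by
  classical
  set σ : n → ℤ := fun j => if 0 ≤ y j then 1 else -1 with hσ
  have hσσ : ∀ j, σ j * σ j = 1 := fun j => by simp only [hσ]; split_ifs <;> rfl
  have hσabs : ∀ j, |σ j| = 1 := fun j => by simp only [hσ]; split_ifs <;> rfl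
  have hσy : ∀ j, y j = σ j * |y j| := fun j => by
    simp only [hσ]
    split_ifs with h
    · rw [abs_of_nonneg h, one_mul]
    · rw [abs_of_neg (not_le.1 h)]; ring
  -- Merged columns are pairs of a block and a signed column; keeping the block preserves the tree.
  let f : n → ι × (m → ℤ) := fun j => (block j, fun i => σ j * M i j)
  let n' := Set.range f
  have : Fintype n' := (Set.finite_range f).fintype
  let g : n → n' := fun j => ⟨f j, j, rfl⟩
  have hg : Function.Surjective g := by
    rintro ⟨_, j, rfl⟩
    exact ⟨j, rfl⟩
  let M' : Matrix m n' ℤ := fun i c => c.1.2 i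
  let block' : n' → ι := fun c => c.1.1
  have hMg : ∀ i j, M' i (g j) = σ j * M i j := fun i j => rfl
  have hbg : ∀ j, block' (g j) = block j := fun j => rfl
  have hsum : ∀ (x : n → ℤ) (i : m), ∑ c, M' i c * ∑ j with g j = c, x j =
      ∑ j, M i j * (σ j * x j) := fun x i => by
    rw [← Finset.sum_fiberwise Finset.univ g]
    refine Finset.sum_congr rfl fun c _ => ?_
    rw [Finset.mul_sum]
    refine Finset.sum_congr rfl fun j hj => ?_
    rw [← (Finset.mem_filter.1 hj).2, hMg]
    ring
  have hcyc : ∀ x : n → ℤ, IsCycle M' (fun c => ∑ j with g j = c, x j) ↔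
      IsCycle M fun j => σ j * x j := fun x => by
    simp only [IsCycle, funext_iff, Matrix.mulVec, dotProduct, hsum, Pi.zero_apply]
  have hMS' : IsMultiStage M' rows block' :=
    ⟨fun i c hi => by
      obtain ⟨j, rfl⟩ := hg c
      rw [hMg, hMS.eq_zero i j hi, mul_zero], hMS.chain_above, hMS.rows_subset, hMS.rows_disjoint⟩
  have hM' : ∀ i c, |M' i c| ≤ (Δ : ℤ) := fun i c => by
    obtain ⟨j, rfl⟩ := hg c
    rw [hMg, abs_mul, hσabs, one_mul]
    exact hM i j
  have hs' : ∀ (a : ι) (k : ℕ), 1 ≤ k → Order.height a = (k : ℕ∞) →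
      (Finset.univ.filter fun c : n' => block' c = a).card ≤ s k := fun a k hk ha => by
    refine (Finset.card_le_card (t := (Finset.univ.filter fun j : n => block j = a).image g)
      fun c hc => ?_).trans (Finset.card_image_le.trans (hs a k hk ha))
    obtain ⟨j, rfl⟩ := hg c
    simp only [Finset.mem_filter, Finset.mem_univ, true_and, hbg] at hc
    exact Finset.mem_image_of_mem _ (by simpa using hc)
  have hq' : ∀ a : ι, IsMin a →
      (Finset.univ.filter fun c : n' => block' c = a).card ≤ (2 * Δ + 1) ^ r := fun a ha => by
    have hinj : Set.InjOn (fun (c : n') i => M' i c)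
        (Finset.univ.filter fun c : n' => block' c = a : Finset n') := by
      intro c hc c' hc' h
      simp only [Finset.coe_filter, Finset.mem_univ, true_and, Set.mem_ofPred_eq] at hc hc'
      exact Subtype.ext (Prod.ext (hc.trans hc'.symm) h)
    rw [← Finset.card_image_of_injOn hinj]
    refine (card_le_of_supported (R := rows a) (Δ := Δ) ?_ ?_).trans
      (Nat.pow_le_pow_right (by omega) (hr a ha))
    · simp only [Finset.mem_image]
      rintro _ ⟨c, -, rfl⟩ i
      exact hM' i c
    · simp only [Finset.mem_image, Finset.mem_filter, Finset.mem_univ, true_and]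
      rintro _ ⟨c, hc, rfl⟩ i hi
      exact hMS'.eq_zero i c (by rwa [hc])
  have hycyc : IsCycle M' fun c => ∑ j with g j = c, |y j| := by
    rw [hcyc]
    simpa only [← hσy] using hy.1
  have hle := hMS'.le_of_minimal_nonneg_cycle hΔ ht hs' hr hq' hM'
    (fun c => Finset.sum_nonneg fun j _ => abs_nonneg (y j)) hycyc ?_ (g k)
  · refine le_trans ?_ hle
    exact Finset.single_le_sum (f := fun j => |y j|) (fun j _ => abs_nonneg _) (by simp)
  -- A smaller cycle `u` of the merged matrix lifts to a sign-compatible splitting of `y`, so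
  -- indecomposability forces one part to vanish.
  · intro u hu0 huy hucyc
    choose b hb0 hba hbs using fun c => exists_le_sum_eq (Finset.univ.filter fun j => g j = c)
      (fun j => abs_nonneg (y j)) (u c) (hu0 c) (huy c)
    set x : n → ℤ := fun j => b (g j) j with hx
    have hxu : ∀ c, ∑ j with g j = c, x j = u c := fun c => by
      rw [← hbs c]
      exact Finset.sum_congr rfl fun j hj => by rw [hx, ← (Finset.mem_filter.1 hj).2]
    have hxcyc : IsCycle M fun j => σ j * x j := by
      rw [← hcyc, funext hxu]
      exact hucyc
    have hycyc' : IsCycle M fun j => σ j * (|y j| - x j) := by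
      have h1 : (fun j => σ j * (|y j| - x j)) = y - fun j => σ j * x j := by
        funext j
        rw [mul_sub, ← hσy, Pi.sub_apply]
      have h2 := hy.1
      unfold IsCycle at hxcyc h2 ⊢
      rw [h1, Matrix.mulVec_sub, h2, hxcyc, sub_zero]
    by_contra hne
    push Not at hne
    refine hy.2 ⟨_, _, hxcyc, hycyc', fun h => hne.1 ?_, fun h => hne.2 ?_, ?_, fun j => ?_⟩
    · funext c
      rw [← hxu, Pi.zero_apply]
      refine Finset.sum_eq_zero fun j _ => ?_
      have := congrArg (σ j * ·) (congrFun h j)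
      simpa [← mul_assoc, hσσ] using this
    · funext c
      rw [← hxu]
      refine Finset.sum_congr rfl fun j _ => ?_
      have := congrArg (σ j * ·) (congrFun h j)
      simp only [← mul_assoc, hσσ, one_mul, Pi.zero_apply, mul_zero] at this
      omega
    · funext j
      rw [Pi.add_apply, ← mul_add, add_sub_cancel, ← hσy]
    · have h1 : σ j * x j * (σ j * (|y j| - x j)) = (σ j * σ j) * (x j * (|y j| - x j)) := by ring
      rw [h1, hσσ, one_mul]
      exact mul_nonneg (hb0 _ _) (sub_nonneg.2 (hba _ _))

/-! ### Numerical estimates -/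

lemma le_two_pow_sub_one {c : ℕ} (hc : 1 ≤ c) : c ≤ 2 ^ (c - 1) := by
  have := Nat.lt_two_pow_self (n := c - 1)
  omega

lemma one_le_expTower {x : ℕ} (hx : 1 ≤ x) : ∀ k, 1 ≤ expTower k x
  | 0 => hx
  | _ + 1 => Nat.one_le_two_pow

/-- A factor c in front of 2^e costs c - 1 in the exponent, and c - 1 + e ≤ ce; hence it can be
pushed to the bottom of the tower. -/
lemma mul_expTower_le {c x : ℕ} (hc : 1 ≤ c) (hx : 1 ≤ x) (k : ℕ) :
    c * expTower k x ≤ expTower k (x * c) := by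
  induction k with
  | zero => exact (Nat.mul_comm _ _).le
  | succ k ih =>
    have he := one_le_expTower hx k
    calc c * 2 ^ expTower k x ≤ 2 ^ (c - 1) * 2 ^ expTower k x :=
          Nat.mul_le_mul_right _ (le_two_pow_sub_one hc)
      _ = 2 ^ (c - 1 + expTower k x) := (pow_add _ _ _).symm
      _ ≤ 2 ^ expTower k (x * c) := Nat.pow_le_pow_right (by norm_num) (le_trans (by
          obtain ⟨c, rfl⟩ := Nat.exists_eq_add_of_le hc
          obtain ⟨e, h⟩ := Nat.exists_eq_add_of_le he
          rw [h, Nat.add_sub_cancel_left]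
          nlinarith [Nat.zero_le (c * e)]) ih)

theorem stageBound_le_expTower {K : ℕ} (hK : 1 ≤ K) {s : ℕ → ℕ} {r Δ : ℕ} (hΔr : 2 ≤ Δ * r) (t : ℕ)
    (hs : ∀ i, 1 ≤ i → i ≤ t → 1 ≤ s i) :
    stageBound K s r Δ t ≤
      expTower (t + 1) (K * Δ * r ^ 2 * ∏ i ∈ Finset.Icc 1 t, (K * s i ^ 2)) := by
  have hΔ : 0 < Δ := Nat.pos_of_ne_zero fun h => by simp [h] at hΔr
  have hr : 0 < r := Nat.pos_of_ne_zero fun h => by simp [h] at hΔr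
  induction t with
  | zero =>
    calc (Δ * r) ^ (K * r) ≤ (2 ^ (Δ * r)) ^ (K * r) :=
          Nat.pow_le_pow_left Nat.lt_two_pow_self.le _
      _ = 2 ^ (K * Δ * r ^ 2) := by rw [← pow_mul]; congr 1; ring
      _ = _ := by simp [expTower]
  | succ t ih =>
    have ih := ih fun i h1 h2 => hs i h1 (h2.trans t.le_succ)
    have hpos : ∀ i ∈ Finset.Icc 1 t, 0 < K * s i ^ 2 := fun i hi => by
      rw [Finset.mem_Icc] at hi
      have := hs i hi.1 (hi.2.trans t.le_succ)
      positivity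
    have hprod := Finset.prod_pos hpos
    rw [Finset.prod_Icc_succ_top (by omega), ← mul_assoc]
    set x := K * Δ * r ^ 2 * ∏ i ∈ Finset.Icc 1 t, (K * s i ^ 2) with hx
    have hx1 : 0 < x := by positivity
    have hc : 0 < K * s (t + 1) ^ 2 := by
      have := hs (t + 1) (by omega) le_rfl
      positivity
    refine Nat.pow_le_pow_right (by norm_num) ?_
    calc stageBound K s r Δ t ^ (K * s (t + 1) ^ 2)
        ≤ (2 ^ expTower t x) ^ (K * s (t + 1) ^ 2) := Nat.pow_le_pow_left ih _
      _ = 2 ^ (K * s (t + 1) ^ 2 * expTower t x) := by rw [← pow_mul, mul_comm]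
      _ ≤ _ := Nat.pow_le_pow_right (by norm_num) (mul_expTower_le hc hx1 t)

lemma mul_adjoinBound_le {Δ N U s : ℕ} (hU : 2 ≤ U) (hN : Δ * N ≤ U) (hs : 1 ≤ s) :
    Δ * adjoinBound Δ N s ≤ U ^ (6 * s ^ 2) := by
  have h1 : s + 1 ≤ U ^ s := (Nat.lt_two_pow_self (n := s)).trans_le (Nat.pow_le_pow_left hU s)
  have h2 : (s + 1).factorial ≤ (U ^ s) ^ (s + 1) :=
    (Nat.factorial_le_pow _).trans (Nat.pow_le_pow_left h1 _)
  calc Δ * adjoinBound Δ N s = (s + 1) * ((s + 1).factorial * (Δ * N) ^ (s + 2)) := by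
        unfold adjoinBound; ring
    _ ≤ U ^ s * ((U ^ s) ^ (s + 1) * U ^ (s + 2)) := by gcongr
    _ = U ^ (s + (s * (s + 1) + (s + 2))) := by rw [← pow_mul, ← pow_add, ← pow_add]
    _ ≤ U ^ (6 * s ^ 2) := Nat.pow_le_pow_right (by omega) (by nlinarith)

section leaf

variable {r Δ : ℕ}

lemma factorial_mul_pow_le : r.factorial * Δ ^ r ≤ (Δ * r) ^ r := by
  rw [mul_pow, mul_comm]
  exact Nat.mul_le_mul_left _ (Nat.factorial_le_pow r)

lemma mul_adjoinBound_one_le (hΔr : 2 ≤ Δ * r) : Δ * adjoinBound Δ 1 r ≤ (Δ * r) ^ (5 * r) := by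
  have hr : 1 ≤ r := Nat.pos_of_ne_zero fun h => by simp [h] at hΔr
  have h1 : r + 1 ≤ (Δ * r) ^ r :=
    (Nat.lt_two_pow_self (n := r)).trans_le (Nat.pow_le_pow_left hΔr r)
  have h2 : Δ ^ 2 ≤ (Δ * r) ^ (2 * r) :=
    (Nat.pow_le_pow_left (Nat.le_mul_of_pos_right _ hr) 2).trans
      (Nat.pow_le_pow_right (by omega) (by omega))
  calc Δ * adjoinBound Δ 1 r = (r + 1) * (r + 1) * (r.factorial * Δ ^ r) * Δ ^ 2 := by
        unfold adjoinBound
        rw [Nat.factorial_succ]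
        ring
    _ ≤ (Δ * r) ^ r * (Δ * r) ^ r * (Δ * r) ^ r * (Δ * r) ^ (2 * r) :=
        Nat.mul_le_mul (Nat.mul_le_mul (Nat.mul_le_mul h1 h1) factorial_mul_pow_le) h2
    _ = (Δ * r) ^ (5 * r) := by rw [← pow_add, ← pow_add, ← pow_add]; congr 1; ring

lemma two_mul_add_one_pow_le (hΔr : 2 ≤ Δ * r) : (2 * Δ + 1) ^ r ≤ (Δ * r) ^ (3 * r) := by
  have hΔ : 1 ≤ Δ := Nat.pos_of_ne_zero fun h => by simp [h] at hΔr
  have hr : 1 ≤ r := Nat.pos_of_ne_zero fun h => by simp [h] at hΔr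
  rw [pow_mul]
  refine Nat.pow_le_pow_left ?_ r
  calc 2 * Δ + 1 ≤ 2 ^ 2 * Δ := by omega
    _ ≤ (Δ * r) ^ 2 * (Δ * r) :=
        Nat.mul_le_mul (Nat.pow_le_pow_left hΔr 2) (Nat.le_mul_of_pos_right _ hr)
    _ = (Δ * r) ^ 3 := by ring

end leaf

section numerics

variable {s : ℕ → ℕ} {r Δ : ℕ}

lemma two_le_stageBound {K : ℕ} (hK : 1 ≤ K) (hΔr : 2 ≤ Δ * r) :
    ∀ t, 2 ≤ stageBound K s r Δ t
  | 0 => by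
    have hr : r ≠ 0 := fun h => by simp [h] at hΔr
    exact hΔr.trans (Nat.le_self_pow (mul_ne_zero (by omega) hr) _)
  | t + 1 => by
    have := two_le_stageBound hK hΔr t
    exact Nat.le_self_pow (pow_ne_zero _ (by omega)) 2

lemma add_le_pow {U V s : ℕ} (hU : 2 ≤ U) (hV : V ≤ U) (hs : 1 ≤ s) : V + s ≤ U ^ (6 * s ^ 2) :=
  calc V + s ≤ U ^ s + U ^ s :=
        Nat.add_le_add (hV.trans (Nat.le_self_pow (by omega) U))
          (Nat.lt_two_pow_self.le.trans (Nat.pow_le_pow_left hU s))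
    _ = 2 * U ^ s := (two_mul _).symm
    _ ≤ U * U ^ s := Nat.mul_le_mul_right _ hU
    _ = U ^ (s + 1) := (pow_succ' _ _).symm
    _ ≤ U ^ (6 * s ^ 2) := Nat.pow_le_pow_right (by omega) (by nlinarith)

/-- Both quantities grow by at most the power 6s² per level, far less than the exponential step of
`stageBound`. The second one bounds the number of nonzero entries in a row after merging. -/
lemma levelBound_le_stageBound (hΔr : 2 ≤ Δ * r) (t : ℕ) (hs : ∀ i, 1 ≤ i → i ≤ t → 1 ≤ s i) :
    Δ * levelBound s r Δ t ≤ stageBound 24 s r Δ t ∧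
      (2 * Δ + 1) ^ r + ∑ k ∈ Finset.range t, s (k + 1) ≤ stageBound 24 s r Δ t := by
  induction t with
  | zero =>
    refine ⟨(mul_adjoinBound_one_le hΔr).trans ?_, ?_⟩
    · exact Nat.pow_le_pow_right (by omega) (by omega)
    · simpa [stageBound] using (two_mul_add_one_pow_le hΔr).trans
        (Nat.pow_le_pow_right (by omega) (show 3 * r ≤ 24 * r by omega))
  | succ t ih =>
    obtain ⟨ih1, ih2⟩ := ih fun i h1 h2 => hs i h1 (h2.trans t.le_succ)
    have hU := two_le_stageBound (s := s) (K := 24) (by norm_num) hΔr t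
    have hst := hs (t + 1) (by omega) le_rfl
    have hle : stageBound 24 s r Δ t ^ (6 * s (t + 1) ^ 2) ≤ stageBound 24 s r Δ (t + 1) :=
      Nat.lt_two_pow_self.le.trans (Nat.pow_le_pow_right (by norm_num)
        (Nat.pow_le_pow_right (by omega) (by omega)))
    refine ⟨(mul_adjoinBound_le hU ih1 hst).trans hle, ?_⟩
    rw [Finset.sum_range_succ, ← add_assoc]
    exact (add_le_pow hU ih2 hst).trans hle

lemma factorial_mul_le_two_pow {X V ρ : ℕ} (hV : 2 ≤ V) (hX : X ≤ V) (hρ : ρ ≤ V) :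
    X.factorial * (X * (ρ * X + 1)) ≤ 2 ^ V ^ 4 := by
  have hVV : V ≤ 2 ^ V := Nat.lt_two_pow_self.le
  have h1 : X.factorial ≤ 2 ^ (V * V) := by
    rw [pow_mul]
    exact (Nat.factorial_le hX).trans ((Nat.factorial_le_pow V).trans (Nat.pow_le_pow_left hVV V))
  have h2 : ρ * X + 1 ≤ 2 ^ (2 * V + 1) :=
    calc ρ * X + 1 ≤ V * V + V * V :=
          Nat.add_le_add (Nat.mul_le_mul hρ hX) (Nat.mul_pos (by omega) (by omega))
      _ ≤ 2 ^ V * 2 ^ V + 2 ^ V * 2 ^ V :=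
          Nat.add_le_add (Nat.mul_le_mul hVV hVV) (Nat.mul_le_mul hVV hVV)
      _ = 2 ^ (2 * V + 1) := by ring
  calc X.factorial * (X * (ρ * X + 1)) ≤ 2 ^ (V * V) * (2 ^ V * 2 ^ (2 * V + 1)) :=
        Nat.mul_le_mul h1 (Nat.mul_le_mul (hX.trans hVV) h2)
    _ = 2 ^ (V * V + (V + (2 * V + 1))) := by rw [← pow_add, ← pow_add]
    _ ≤ 2 ^ V ^ 4 := Nat.pow_le_pow_right (by norm_num) (by
        have h3 : 4 ≤ V * V := Nat.mul_le_mul hV hV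
        calc V * V + (V + (2 * V + 1)) ≤ 4 * (V * V) := by nlinarith
          _ ≤ V * V * (V * V) := Nat.mul_le_mul_right _ h3
          _ = V ^ 4 := by ring)

/-- At depth 0 the exponents add up to r + 5r + 3r + 5r = 14r, plus one for a factor 2. At positive
depth, the factorial of a number at most V = U^{6s²}, with the remaining factors, is at most 2^{V⁴};
this gives the constant 24 = 6 · 4. -/
theorem cycleBound_le_stageBound (hΔr : 2 ≤ Δ * r) (t : ℕ) (hs : ∀ i, 1 ≤ i → i ≤ t → 1 ≤ s i) :
    cycleBound s r Δ ((2 * Δ + 1) ^ r) t ≤ stageBound 24 s r Δ t := by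
  have hr : 1 ≤ r := Nat.pos_of_ne_zero fun h => by simp [h] at hΔr
  cases t with
  | zero =>
    have hX := mul_adjoinBound_one_le hΔr
    calc cycleBound s r Δ ((2 * Δ + 1) ^ r) 0
        = r.factorial * Δ ^ r * (Δ * adjoinBound Δ 1 r) *
          ((2 * Δ + 1) ^ r * (Δ * adjoinBound Δ 1 r) + 1) := by
          simp only [cycleBound, denominatorBound, levelBound, Finset.range_zero, Finset.sum_empty]
          ring
      _ ≤ (Δ * r) ^ r * (Δ * r) ^ (5 * r) *
          ((Δ * r) ^ (3 * r) * (Δ * r) ^ (5 * r) + (Δ * r) ^ (3 * r) * (Δ * r) ^ (5 * r)) := by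
          refine Nat.mul_le_mul (Nat.mul_le_mul factorial_mul_pow_le hX)
            (Nat.add_le_add (Nat.mul_le_mul (two_mul_add_one_pow_le hΔr) hX) ?_)
          exact Nat.mul_pos (pow_pos (by omega) _) (pow_pos (by omega) _)
      _ = 2 * (Δ * r) ^ (14 * r) := by
          rw [← two_mul, ← pow_add, ← pow_add, mul_left_comm, ← pow_add]
          congr 2
          ring
      _ ≤ (Δ * r) ^ (14 * r + 1) := by
          rw [pow_succ']
          exact Nat.mul_le_mul_right _ hΔr
      _ ≤ (Δ * r) ^ (24 * r) := Nat.pow_le_pow_right (by omega) (by omega)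
  | succ t =>
    obtain ⟨h1, h2⟩ :=
      levelBound_le_stageBound hΔr t fun i h1 h2 => hs i h1 (h2.trans t.le_succ)
    have hU := two_le_stageBound (s := s) (K := 24) (by norm_num) hΔr t
    have hst := hs (t + 1) (by omega) le_rfl
    have hX : Δ * levelBound s r Δ (t + 1) ≤ stageBound 24 s r Δ t ^ (6 * s (t + 1) ^ 2) :=
      mul_adjoinBound_le hU h1 hst
    have hρ : (2 * Δ + 1) ^ r + ∑ k ∈ Finset.range (t + 1), s (k + 1) ≤
        stageBound 24 s r Δ t ^ (6 * s (t + 1) ^ 2) := by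
      rw [Finset.sum_range_succ, ← add_assoc]
      exact add_le_pow hU h2 hst
    have hV : 2 ≤ stageBound 24 s r Δ t ^ (6 * s (t + 1) ^ 2) :=
      hU.trans (Nat.le_self_pow (by positivity) _)
    have := factorial_mul_le_two_pow hV hX hρ
    rw [← pow_mul, show 6 * s (t + 1) ^ 2 * 4 = 24 * s (t + 1) ^ 2 by ring] at this
    refine le_trans (le_of_eq ?_) this
    simp only [cycleBound, denominatorBound]
    ring

end numerics

/-- The level of a block `a` is its height `Order.height a` in the tree, so leaves have level `0`,
and the depth `t` of the tree is the level of the root. -/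
theorem mainTheorem3 :
    ∃ K : ℕ, ∀ (t : ℕ) (s : ℕ → ℕ) (r Δ : ℕ),
      (∀ i, 1 ≤ i → i ≤ t → 1 ≤ s i) → 2 ≤ Δ * r →
      stageBound K s r Δ t ≤
          expTower (t + 1) (K * Δ * r ^ 2 * ∏ i ∈ Finset.Icc 1 t, (K * s i ^ 2)) ∧
      ∀ (m n ι : Type) [Fintype m] [Fintype n] [Fintype ι] [DecidableEq ι]
        [PartialOrder ι] [OrderTop ι]
        (M : Matrix m n ℤ) (rows : ι → Finset m) (block : n → ι),
        IsMultiStage M rows block →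
        Order.height (⊤ : ι) = (t : ℕ∞) →
        (∀ (a : ι) (k : ℕ), 1 ≤ k → Order.height a = (k : ℕ∞) →
          (Finset.univ.filter fun j : n => block j = a).card ≤ s k) →
        (∀ a : ι, IsMin a → (rows a).card ≤ r) →
        (∀ i j, |M i j| ≤ (Δ : ℤ)) →
        ∀ y : n → ℤ, IsIndecomposableCycle M y →
          ‖y‖ ≤ (stageBound K s r Δ t : ℝ) := by
  refine ⟨24, fun t s r Δ hs hΔr => ⟨stageBound_le_expTower (by norm_num) hΔr t hs, ?_⟩⟩
  intro m n ι _ _ _ _ _ _ M rows block hMS ht hcols hr hM y hy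
  have hΔ : 1 ≤ Δ := Nat.pos_of_ne_zero fun h => by simp [h] at hΔr
  refine (pi_norm_le_iff_of_nonneg (Nat.cast_nonneg _)).2 fun k => ?_
  have h1 := hMS.abs_le_of_isIndecomposableCycle hΔ ht hcols hr hM hy k
  have h2 : |y k| ≤ (stageBound 24 s r Δ t : ℤ) :=
    h1.trans (Int.ofNat_le.2 (cycleBound_le_stageBound hΔr t hs))
  rw [Int.norm_eq_abs]
  exact_mod_cast h2
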